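/- A hybrid dynamical system is a tuple $H=(D,F,G,R)$ where $D=\coprod_{j\in J}D_j$ is a finite disjoint union of connected smooth manifolds with boundary, of possibly different dimensions $\dim D_j\ge 1$, $F$ is a smooth vector field on $D$, the guard $G\subset\partial D$ is an open subset of $\partial D$, and the reset map $R:G\to D$ is smooth. Assume that $F$ is outward-pointing on $G$. An execution of $H$ is a right-continuous function $x:T\to D$ on an interval $T\subset\mathbb{R}$ such that, at each $t\in T$: if $x$ is continuous at $t$, then $x$ is differentiable at $t$ and $\dot x(t)=F(x(t))$; if $x$ is discontinuous at $t$, then $x(t^-)=\lim_{s\to t^-}x(s)$ exists, lies in $G$, and $R(x(t^-))=x(t)$. Let $\gamma:\mathbb{R}\to D$ be a periodic orbit of $H$, i.e. a (nonequilibrium) execution with a minimal period $\tau>0$, having only finitely many discontinuities in each bounded time interval. The exit points $\gamma(t^-)$ are counted as points of the orbit. Let $\Sigma\subset D_{j_0}$ be an embedded submanifold of codimension one that meets the orbit in exactly one point $\xi$. Let $U\subset\Sigma$ be open with $\xi\in U$, and let $P:U\to\Sigma$ be a smooth map which is a Poincaré map for $\gamma$: for every $x\in U$ there is an execution with finitely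 many transitions that starts at $x$ (at $R(x)$ if $x\in G$) and, after a positive time, meets $\Sigma$ again (exit points included) for the first time at the point $P(x)$, and that before this return has been, as $\gamma$ has, in every domain $D_j$ that $\gamma$ visits. Then $$\operatorname{rank} DP(x)\;\le\;\min\{\dim D_j : \gamma \text{ visits } D_j\}-1\qquad\text{for every }x\in U.$$ In particular, if $\gamma$ visits every domain, then $\operatorname{rank} DP(x)\le \min_{j\in J}\dim D_j-1$ for every $x\in U$. -/

import Mathlib

open Set Filter Topology Manifold
open scoped ContDiff

universe u v

/-- A hybrid dynamical system `(D, F, G, R)` over an index type `J`.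
The domain is the disjoint union of the connected smooth manifolds with boundary `D j`, of
dimension `dim j ≥ 1`. -/
structure HybridSystem (J : Type u) where
  /-- the dimension of the `j`-th domain -/
  dim : J → ℕ
  [dim_neZero : ∀ j, NeZero (dim j)]
  /-- the `j`-th domain -/
  D : J → Type v
  [topD : ∀ j, TopologicalSpace (D j)]
  [t2D : ∀ j, T2Space (D j)]
  [secondCountableD : ∀ j, SecondCountableTopology (D j)]
  [connectedD : ∀ j, ConnectedSpace (D j)]
  [chartedD : ∀ j, ChartedSpace (EuclideanHalfSpace (dim j)) (D j)]
  [manifoldD : ∀ j, IsManifold (𝓡∂ (dim j)) ∞ (D j)]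
  /-- the vector field -/
  F : ∀ (j : J) (p : D j), TangentSpace (𝓡∂ (dim j)) p
  smooth_F : ∀ j, ContMDiff (𝓡∂ (dim j)) (𝓡∂ (dim j)).tangent ∞
    (fun p : D j => (⟨p, F j p⟩ : TangentBundle (𝓡∂ (dim j)) (D j)))
  /-- the part of the guard in the `j`-th domain -/
  G : ∀ j, Set (D j)
  /-- the guard is a relatively open subset of the boundary -/
  guard_open : ∀ j, ∃ O : Set (D j), IsOpen O ∧ G j = O ∩ (𝓡∂ (dim j)).boundary (D j)
  /-- the reset map; only its values at points of the guard matter -/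
  R : (Σ j, D j) → (Σ j, D j)
  /-- the reset map is smooth on the guard: locally it takes values in a single domain and is
  smooth as a map to that domain -/
  smooth_R : ∀ (j : J), ∀ p ∈ G j, ∃ (k : J) (r : D j → D k),
    (∀ᶠ q in 𝓝[G j] p, R ⟨j, q⟩ = ⟨k, r q⟩) ∧
    ContMDiffWithinAt (𝓡∂ (dim j)) (𝓡∂ (dim k)) ∞ r (G j) p

attribute [instance] HybridSystem.dim_neZero HybridSystem.topD HybridSystem.t2D
  HybridSystem.secondCountableD HybridSystem.connectedD HybridSystem.chartedD
  HybridSystem.manifoldD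

namespace HybridSystem

variable {J : Type u}

/-- The total space `D = ∐ j, D j`, with the disjoint union topology. -/
abbrev State (H : HybridSystem.{u, v} J) : Type (max u v) := Σ j, H.D j

/-- The guard as a subset of the total space. -/
def guard (H : HybridSystem.{u, v} J) : Set H.State := {x | x.2 ∈ H.G x.1}

/-- The vector field is outward-pointing on the guard: at each point of the guard, in every
smooth chart, the coordinate of `F` that is nonnegative on the half-space is negative. -/
def OutwardOnGuard (H : HybridSystem.{u, v} J) : Prop :=
  ∀ (j : J), ∀ p ∈ H.G j,
    ∀ φ ∈ IsManifold.maximalAtlas (𝓡∂ (H.dim j)) ∞ (H.D j), p ∈ φ.source →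
      let w : EuclideanSpace ℝ (Fin (H.dim j)) :=
        mfderiv (𝓡∂ (H.dim j)) 𝓘(ℝ, EuclideanSpace ℝ (Fin (H.dim j)))
          (φ.extend (𝓡∂ (H.dim j))) p (H.F j p)
      w 0 < 0

/-- Within `T`, the curve `χ` is differentiable at `t` with derivative `F (χ t)`. -/
def HasFlowDerivAt (H : HybridSystem.{u, v} J) (χ : ℝ → H.State) (T : Set ℝ) (t : ℝ) : Prop :=
  ∃ (j : J) (y : ℝ → H.D j), (∀ᶠ s in 𝓝[T] t, χ s = ⟨j, y s⟩) ∧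
    HasMFDerivWithinAt 𝓘(ℝ, ℝ) (𝓡∂ (H.dim j)) y T t
      ((1 : ℝ →L[ℝ] ℝ).smulRight (H.F j (y t)))

/-- `χ` is an execution over the interval `T`. -/
structure IsExecution (H : HybridSystem.{u, v} J) (χ : ℝ → H.State) (T : Set ℝ) : Prop where
  ordConnected : T.OrdConnected
  rightContinuous : ∀ t ∈ T, ContinuousWithinAt χ (T ∩ Ici t) t
  flow : ∀ t ∈ T, ContinuousWithinAt χ T t → H.HasFlowDerivAt χ T t
  jump : ∀ t ∈ T, ¬ ContinuousWithinAt χ T t →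
    ∃ z ∈ H.guard, Tendsto χ (𝓝[T ∩ Iio t] t) (𝓝 z) ∧ H.R z = χ t

/-- `γ` is a (nonequilibrium) periodic orbit with period `τ`, defined for all times. -/
structure IsPeriodicOrbit (H : HybridSystem.{u, v} J) (γ : ℝ → H.State) (τ : ℝ) : Prop where
  execution : H.IsExecution γ univ
  pos : 0 < τ
  periodic : Function.Periodic γ τ
  minimal : ∀ σ, 0 < σ → σ < τ → ∀ s, γ (s + σ) ≠ γ s

/-- `γ` undergoes isolated transitions: finitely many in every bounded time interval. -/
def IsolatedTransitions (H : HybridSystem.{u, v} J) (γ : ℝ → H.State) : Prop :=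
  ∀ a b : ℝ, {t ∈ Icc a b | ¬ ContinuousAt γ t}.Finite

/-- The point set traced by `γ`. As the orbit leaves a domain through the guard, the exit points
`γ (t⁻)` are counted as points of the orbit. -/
def trace (H : HybridSystem.{u, v} J) (γ : ℝ → H.State) : Set H.State :=
  {z | ∃ t, γ t = z ∨ Tendsto γ (𝓝[<] t) (𝓝 z)}

/-- The indices of the domains that `γ` visits. -/
def visited (H : HybridSystem.{u, v} J) (γ : ℝ → H.State) : Set J :=
  {j | ∃ t, (γ t).1 = j}

/-- The execution `χ`, started at `x` at time `0`, meets the section `S` again for the first time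
at time `T > 0`, in the point `y`. If `x` lies in the guard, then it is first reset. The exit
points `χ (t⁻)` are counted as points that the execution passes, so `y` is `χ (T⁻)` if this point
lies in `S`, and otherwise it is the point to which `χ (T⁻)` is reset. -/
structure IsFirstReturn (H : HybridSystem.{u, v} J) (S : Set H.State) (χ : ℝ → H.State) (T : ℝ)
    (x y : H.State) : Prop where
  pos : 0 < T
  execution : H.IsExecution χ (Ico 0 T)
  finite_transitions : {t ∈ Ico 0 T | ¬ ContinuousWithinAt χ (Ico 0 T) t}.Finite
  start : χ 0 = x ∨ (x ∈ H.guard ∧ χ 0 = H.R x ∧ χ 0 ∉ S)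
  value_notMem : ∀ t ∈ Ioo 0 T, χ t ∉ S
  leftLim_notMem : ∀ t ∈ Ioo 0 T, ∀ z, Tendsto χ (𝓝[<] t) (𝓝 z) → z ∉ S
  mem : y ∈ S
  arrive : ∃ z, Tendsto χ (𝓝[<] T) (𝓝 z) ∧ (y = z ∨ (z ∉ S ∧ z ∈ H.guard ∧ y = H.R z))

section Section

variable {E : Type*} [NormedAddCommGroup E] [NormedSpace ℝ E]
  {B : Type*} [TopologicalSpace B]

/-- The embedded submanifold `ι : S → D j₀` is a Poincaré section for `γ`: it has codimension one
and meets the orbit exactly in the point `ξ`. -/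
structure IsPoincareSection (H : HybridSystem.{u, v} J) (γ : ℝ → H.State)
    (I : ModelWithCorners ℝ E B) {S : Type*} [TopologicalSpace S] [ChartedSpace B S] {j₀ : J}
    (ι : S → H.D j₀) (ξ : S) : Prop where
  codim_one : Module.finrank ℝ E + 1 = H.dim j₀
  smooth : ContMDiff I (𝓡∂ (H.dim j₀)) ∞ ι
  embedding : IsEmbedding ι
  immersion : ∀ p, Function.Injective (mfderiv I (𝓡∂ (H.dim j₀)) ι p)
  inter_orbit : H.trace γ ∩ range (fun p => (⟨j₀, ι p⟩ : H.State)) = {⟨j₀, ι ξ⟩}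

/-- `P : U → S` is a Poincaré map for `γ` on the section `ι : S → D j₀`: it is a smooth map on the
open set `U ∋ ξ`, and `P p` is the point where the execution from `p` first returns to the
section, after it has been, like `γ`, through every domain that `γ` visits. -/
structure IsPoincareMap (H : HybridSystem.{u, v} J) (γ : ℝ → H.State)
    (I : ModelWithCorners ℝ E B) {S : Type*} [TopologicalSpace S] [ChartedSpace B S] {j₀ : J}
    (ι : S → H.D j₀) (ξ : S) (U : Set S) (P : S → S) : Prop where
  isSection : H.IsPoincareSection γ I ι ξ
  isOpen : IsOpen U
  mem : ξ ∈ U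
  smooth : ContMDiffOn I I ∞ P U
  returns : ∀ p ∈ U, ∃ (χ : ℝ → H.State) (T : ℝ),
    H.IsFirstReturn (range fun q => (⟨j₀, ι q⟩ : H.State)) χ T ⟨j₀, ι p⟩ ⟨j₀, ι (P p)⟩ ∧
    ∀ j ∈ H.visited γ, j = j₀ ∨ ∃ t ∈ Ico 0 T, (χ t).1 = j

end Section

end HybridSystem

open scoped NNReal ENNReal
open MeasureTheory MeasureTheory.Measure

/-! Fix a visited domain `D j`. If it contains the section, the rank is at most the dimension of the
section, which is `dim j - 1`. Otherwise an execution that has been in `D j` can return only after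
leaving through the guard, which lies in the boundary and so has dimension `m = dim j - 1`. What
happens afterwards cannot raise the dimension enough for `P` to have rank `m + 1`.

Flowing for all times would add a dimension, so only countably many local operations are admitted:
flowing for a rational time, flowing up to the guard, resetting. Each is locally Lipschitz in
charts, the second because the field is transverse to the boundary at the guard. Hence the closure
`W` of the guard of `D j` under them is still covered by countably many Lipschitz images of subsets
of `ℝ ^ m` (`exists_isReachClosed`). By induction over the finitely many transitions, `W` contains
the state after each transition that follows the visit to `D j`
(`IsExecution.exists_last_transition`).

The last arc, from `W` to the section, may be tangent to the section, so its end point need not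
depend on its start in a Lipschitz way. But it stops at a first hit: each parameter in `ℝ ^ m` has
at most one first hitting time, so by Fubini the pairs (parameter, time) form a null set, and the
Lipschitz flow maps it to a null set for the Hausdorff measure of dimension `m + 1`
(`hausdorffMeasure_firstHit`). Thus `P` takes values locally in such a null set. Rank `m + 1` or
more would make a linear projection of the image a neighbourhood in `ℝ ^ (m + 1)`, of positive
measure (`finrank_range_fderivWithin_le`). -/

/-! ### Sets covered by countably many Lipschitz images of subsets of `ℝ ^ m` -/

/-- The set `B` is covered by countably many Lipschitz images of subsets of `ℝ ^ m`. -/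
def LipRectifiable (m : ℕ) {X : Type*} [PseudoMetricSpace X] (B : Set X) : Prop :=
  ∃ C : Set (Set X), C.Countable ∧ B ⊆ ⋃₀ C ∧
    ∀ t ∈ C, ∃ (K : ℝ≥0) (f : (Fin m → ℝ) → X) (s : Set (Fin m → ℝ)),
      LipschitzOnWith K f s ∧ t = f '' s

namespace LipRectifiable

variable {m : ℕ} {X Y : Type*} [PseudoMetricSpace X] [PseudoMetricSpace Y]

theorem mono {A B : Set X} (hB : LipRectifiable m B) (h : A ⊆ B) : LipRectifiable m A := by
  obtain ⟨C, hC, hBC, hf⟩ := hB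
  exact ⟨C, hC, h.trans hBC, hf⟩

theorem empty : LipRectifiable m (∅ : Set X) :=
  ⟨∅, countable_empty, empty_subset _, by simp⟩

theorem image_of_lipschitzOnWith {f : (Fin m → ℝ) → X} {s : Set (Fin m → ℝ)} {K : ℝ≥0}
    (hf : LipschitzOnWith K f s) : LipRectifiable m (f '' s) :=
  ⟨{f '' s}, countable_singleton _, by simp, by rintro t rfl; exact ⟨K, f, s, hf, rfl⟩⟩

theorem iUnion {κ : Type*} [Countable κ] {B : κ → Set X} (hB : ∀ i, LipRectifiable m (B i)) :
    LipRectifiable m (⋃ i, B i) := by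
  choose C hC hBC hf using hB
  refine ⟨⋃ i, C i, countable_iUnion hC, iUnion_subset fun i => (hBC i).trans ?_, ?_⟩
  · exact sUnion_subset_sUnion (subset_iUnion _ i)
  · intro t ht
    obtain ⟨i, hi⟩ := mem_iUnion.1 ht
    exact hf i t hi

theorem biUnion {κ : Type*} {t : Set κ} (ht : t.Countable) {B : κ → Set X}
    (hB : ∀ i ∈ t, LipRectifiable m (B i)) : LipRectifiable m (⋃ i ∈ t, B i) := by
  have := ht.to_subtype
  rw [biUnion_eq_iUnion]
  exact iUnion fun i : t => hB i i.2

theorem image {B : Set X} (hB : LipRectifiable m B) {g : X → Y} {K : ℝ≥0}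
    (hg : LipschitzOnWith K g B) : LipRectifiable m (g '' B) := by
  obtain ⟨C, hC, hBC, hf⟩ := hB
  refine ⟨(fun t => g '' (B ∩ t)) '' C, hC.image _, ?_, ?_⟩
  · rintro _ ⟨x, hx, rfl⟩
    obtain ⟨t, ht, hxt⟩ := hBC hx
    exact ⟨_, ⟨t, ht, rfl⟩, ⟨x, ⟨hx, hxt⟩, rfl⟩⟩
  · rintro _ ⟨t, ht, rfl⟩
    obtain ⟨K', f, s, hfs, rfl⟩ := hf t ht
    refine ⟨K * K', g ∘ f, s ∩ f ⁻¹' B, ?_, ?_⟩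
    · exact hg.comp (hfs.mono inter_subset_left) fun x hx => hx.2
    · ext y
      constructor
      · rintro ⟨_, ⟨hB, x, hx, rfl⟩, rfl⟩
        exact ⟨x, ⟨hx, hB⟩, rfl⟩
      · rintro ⟨x, ⟨hx, hB⟩, rfl⟩
        exact ⟨f x, ⟨hB, x, hx, rfl⟩, rfl⟩

/-- By the Lindelöf property countably many of the local neighbourhoods suffice, and rectifiability
survives countable unions. -/
theorem image_of_locally_lipschitzOn [SecondCountableTopology X] {B : Set X}
    (hB : LipRectifiable m B) {g : X → Y}
    (hg : ∀ x ∈ B, ∃ K : ℝ≥0, ∃ t ∈ 𝓝[B] x, LipschitzOnWith K g t) :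
    LipRectifiable m (g '' B) := by
  choose! K t ht hK using hg
  obtain ⟨c, hcB, hc, hcover⟩ := TopologicalSpace.countable_cover_nhdsWithin ht
  refine (biUnion hc (B := fun x => g '' (B ∩ t x)) fun x hx => ?_).mono ?_
  · exact (hB.mono inter_subset_left).image ((hK x (hcB hx)).mono inter_subset_right)
  · rintro _ ⟨x, hx, rfl⟩
    obtain ⟨i, hi, hxi⟩ := mem_iUnion₂.1 (hcover hx)
    exact mem_iUnion₂.2 ⟨i, hi, x, ⟨hx, hxi⟩, rfl⟩

/-- The image under a relation satisfying a Lipschitz estimate. -/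
theorem image_rel {Y : Type*} [MetricSpace Y] {B : Set X} (hB : LipRectifiable m B)
    {r : X → Y → Prop} {C : ℝ≥0}
    (hr : ∀ x y x' y', r x y → r x' y' → dist y y' ≤ C * dist x x') :
    LipRectifiable m {y | ∃ x ∈ B, r x y} := by
  classical
  rcases isEmpty_or_nonempty Y with hY | hY
  · rw [eq_empty_of_isEmpty {y | ∃ x ∈ B, r x y}]
    exact empty
  let g : X → Y := fun x => if h : ∃ y, r x y then h.choose else Classical.arbitrary Y
  have hg : ∀ x, (∃ y, r x y) → r x (g x) := fun x h => by
    simp only [g, dif_pos h]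
    exact h.choose_spec
  have hgB : LipschitzOnWith C g (B ∩ {x | ∃ y, r x y}) := by
    refine LipschitzOnWith.of_dist_le_mul fun x hx y hy => ?_
    exact hr _ _ _ _ (hg x hx.2) (hg y hy.2)
  refine ((hB.mono inter_subset_left).image hgB).mono ?_
  rintro y ⟨x, hx, hxy⟩
  refine ⟨x, ⟨hx, y, hxy⟩, ?_⟩
  -- The estimate with equal sources makes the relation single-valued, so the chosen value is `y`
  -- itself.
  have := hr _ _ _ _ (hg x ⟨y, hxy⟩) hxy
  rw [dist_self, mul_zero] at this
  exact dist_le_zero.1 this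

theorem hausdorffMeasure_eq_zero {X : Type*} [MetricSpace X] [MeasurableSpace X] [BorelSpace X]
    {B : Set X} (hB : LipRectifiable m B) : μH[(m + 1 : ℕ)] B = 0 := by
  obtain ⟨C, hC, hBC, hf⟩ := hB
  refine measure_mono_null hBC ((measure_sUnion_null_iff hC).2 fun t ht => ?_)
  obtain ⟨K, f, s, hfs, rfl⟩ := hf t ht
  refine le_antisymm ((hfs.hausdorffMeasure_image_le (Nat.cast_nonneg _)).trans ?_) (zero_le)
  rw [Real.hausdorffMeasure_of_finrank_lt (by simp)]
  simp

end LipRectifiable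

/-! ### Solutions of autonomous differential equations -/

section ODE

variable {E : Type*} [NormedAddCommGroup E] [NormedSpace ℝ E]

/-- The continuous curve `u` on `[a, b]` solves `u' = V u` in the interior of the interval. -/
structure IsSolutionOn (V : E → E) (u : ℝ → E) (a b : ℝ) : Prop where
  continuousOn : ContinuousOn u (Icc a b)
  hasDerivAt : ∀ t ∈ Ioo a b, HasDerivAt u (V (u t)) t

namespace IsSolutionOn

variable {V : E → E} {u w : ℝ → E} {a b c : ℝ} {K : ℝ≥0}

theorem mono (h : IsSolutionOn V u a b) {a' b' : ℝ} (ha : a ≤ a') (hb : b' ≤ b) :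
    IsSolutionOn V u a' b' :=
  ⟨h.continuousOn.mono (Icc_subset_Icc ha hb), fun t ht => h.hasDerivAt t (Ioo_subset_Ioo ha hb ht)⟩

theorem comp_const_add (h : IsSolutionOn V u (c + a) (c + b)) :
    IsSolutionOn V (fun s => u (c + s)) a b := by
  refine ⟨h.continuousOn.comp (by fun_prop) fun t ht => ?_, fun t ht => ?_⟩
  · exact ⟨by linarith [ht.1], by linarith [ht.2]⟩
  · exact (h.hasDerivAt (c + t) ⟨by linarith [ht.1], by linarith [ht.2]⟩).comp_const_add c t

/-- The equation is assumed only at interior times. As `V ∘ u` is continuous up to `a`, the right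
derivative also exists there, which Grönwall's inequality requires. -/
theorem hasDerivWithinAt_Ici (h : IsSolutionOn V u a b) (hV : Continuous V) {t : ℝ}
    (ht : t ∈ Ico a b) : HasDerivWithinAt u (V (u t)) (Ici t) t := by
  have hmem : Ioo t b ∈ 𝓝[>] t := Ioo_mem_nhdsGT ht.2
  have hsub : Ioo t b ⊆ Ioo a b := Ioo_subset_Ioo_left ht.1
  refine hasDerivWithinAt_Ici_of_tendsto_deriv (s := Ioo t b) ?_ ?_ hmem ?_
  · exact fun s hs => (h.hasDerivAt s (hsub hs)).differentiableAt.differentiableWithinAt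
  · exact (h.continuousOn t (Ico_subset_Icc_self ht)).mono (hsub.trans Ioo_subset_Icc_self)
  · have h1 : Tendsto (fun s => V (u s)) (𝓝[>] t) (𝓝 (V (u t))) := by
      refine (hV.tendsto _).comp ?_
      have := (h.continuousOn t (Ico_subset_Icc_self ht)).mono
        (hsub.trans Ioo_subset_Icc_self)
      rw [ContinuousWithinAt, nhdsWithin_Ioo_eq_nhdsGT ht.2] at this
      exact this
    refine h1.congr' ?_
    filter_upwards [hmem] with s hs
    exact (h.hasDerivAt s (hsub hs)).deriv.symm

theorem dist_le (hu : IsSolutionOn V u 0 b) (hw : IsSolutionOn V w 0 b) (hV : LipschitzWith K V)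
    {t : ℝ} (ht : t ∈ Icc 0 b) : dist (u t) (w t) ≤ dist (u 0) (w 0) * Real.exp (K * t) := by
  have := dist_le_of_trajectories_ODE (v := fun _ => V) (fun _ => hV) hu.continuousOn
    (fun t ht => hu.hasDerivWithinAt_Ici hV.continuous ht) hw.continuousOn
    (fun t ht => hw.hasDerivWithinAt_Ici hV.continuous ht) le_rfl t ht
  simpa using this

theorem dist_time_le (hu : IsSolutionOn V u a b) (hV : Continuous V) {L : ℝ}
    (hL : ∀ t ∈ Icc a b, ‖V (u t)‖ ≤ L) {s t : ℝ} (hs : a ≤ s) (hst : s ≤ t) (ht : t ≤ b) :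
    dist (u t) (u s) ≤ L * (t - s) := by
  rw [dist_eq_norm]
  have hu' := hu.mono hs ht
  exact norm_image_sub_le_of_norm_deriv_right_le_segment hu'.continuousOn
    (fun x hx => hu'.hasDerivWithinAt_Ici hV hx)
    (fun x hx => hL x ⟨hs.trans hx.1, hx.2.le.trans ht⟩) t (right_mem_Icc.2 hst)

/-- Two solutions that end on the hyperplane `ℓ = 0`, to which they are transverse: the end points
depend in a Lipschitz way on the initial points. -/
theorem dist_end_le (hV : LipschitzWith K V) (ℓ : E →L[ℝ] ℝ) {L k : ℝ} (hk : 0 < k)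
    {b b' : ℝ} (hb : 0 ≤ b) (hb' : b' ≤ 1) (hbb' : b ≤ b')
    (hu : IsSolutionOn V u 0 b) (hw : IsSolutionOn V w 0 b')
    (hL : ∀ t ∈ Icc 0 b', ‖V (w t)‖ ≤ L) (hl : ∀ t ∈ Icc 0 b', ℓ (V (w t)) ≤ -k)
    (hub : ℓ (u b) = 0) (hwb : ℓ (w b') = 0) :
    dist (u b) (w b') ≤ Real.exp K * (1 + L * ‖ℓ‖ / k) * dist (u 0) (w 0) := by
  have hL0 : 0 ≤ L := (norm_nonneg _).trans (hL 0 ⟨le_rfl, hb.trans hbb'⟩)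
  set δ := Real.exp K * dist (u 0) (w 0) with hδ
  have h1 : dist (u b) (w b) ≤ δ := by
    refine (hu.dist_le (hw.mono le_rfl hbb') hV ⟨hb, le_rfl⟩).trans ?_
    rw [hδ, mul_comm]
    gcongr
    exact mul_le_of_le_one_right K.2 (hbb'.trans hb')
  have h2 : ℓ (w b) ≤ ‖ℓ‖ * δ := by
    have : ℓ (w b) = ℓ (w b - u b) := by rw [map_sub, hub, sub_zero]
    rw [this]
    refine (le_abs_self _).trans ((ℓ.le_opNorm _).trans ?_)
    gcongr
    rwa [← dist_eq_norm, dist_comm]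
  -- Along `w` the height `ℓ` falls at speed at least `k`, so the small height left at time `b` is
  -- used up within a time proportional to `δ`.
  have h3 : ℓ (w b') - ℓ (w b) ≤ -k * (b' - b) := by
    have hd : ∀ t ∈ interior (Icc 0 b'), HasDerivAt (fun t => ℓ (w t)) (ℓ (V (w t))) t := by
      intro t ht
      rw [interior_Icc] at ht
      exact ℓ.hasFDerivAt.comp_hasDerivAt t (hw.hasDerivAt t ht)
    refine (convex_Icc 0 b').image_sub_le_mul_sub_of_deriv_le
      (f := fun t => ℓ (w t)) (ℓ.continuous.comp_continuousOn hw.continuousOn)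
      (fun t ht => (hd t ht).differentiableAt.differentiableWithinAt) (fun t ht => ?_) b ⟨hb, hbb'⟩
      b' ⟨hb.trans hbb', le_rfl⟩ hbb'
    rw [(hd t ht).deriv]
    exact hl t (interior_subset ht)
  have h4 : b' - b ≤ ‖ℓ‖ * δ / k := by
    rw [le_div_iff₀ hk]
    nlinarith
  calc dist (u b) (w b') ≤ dist (u b) (w b) + dist (w b) (w b') := dist_triangle _ _ _
    _ ≤ δ + L * (‖ℓ‖ * δ / k) := by
      refine add_le_add h1 ?_
      rw [dist_comm]
      exact (hw.dist_time_le hV.continuous hL hb hbb' le_rfl).trans (by gcongr)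
    _ = _ := by rw [hδ]; field_simp

end IsSolutionOn

end ODE

/-! ### The set where a flow first hits a closed set -/

section FirstHit

variable {E : Type*} [NormedAddCommGroup E] [NormedSpace ℝ E]

/-- Points of `D` with an earlier hit form a countable union of projections of closed sets, one for
each lower bound `1 / (n + 1)` on the time gap. Closed sets here are σ-compact, and so are their
projections. -/
theorem measurableSet_firstHit {m : ℕ} {D : Set ((Fin m → ℝ) × ℝ)} (hD : IsClosed D) :
    MeasurableSet {p ∈ D | ∀ s < p.2, (p.1, s) ∉ D} := by
  let A : ℕ → Set (ℝ × ((Fin m → ℝ) × ℝ)) := fun n =>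
    {q | (q.2.1, q.1) ∈ D ∧ q.1 + 1 / ((n : ℝ) + 1) ≤ q.2.2}
  have hA : ∀ n, IsClosed (A n) := fun n =>
    (hD.preimage (f := fun q : ℝ × ((Fin m → ℝ) × ℝ) => (q.2.1, q.1)) (by fun_prop)).inter
      (isClosed_le (f := fun q : ℝ × ((Fin m → ℝ) × ℝ) => q.1 + 1 / ((n : ℝ) + 1))
        (g := fun q => q.2.2) (by fun_prop) (by fun_prop))
  have hM : ∀ n, MeasurableSet (Prod.snd '' A n) := fun n => by
    obtain ⟨S, hS, hSA⟩ := ((isSigmaCompact_univ.of_isClosed_subset (hA n) (subset_univ _)).image continuous_snd)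
    rw [← hSA]
    exact MeasurableSet.iUnion fun i => (hS i).measurableSet
  convert hD.measurableSet.diff (MeasurableSet.iUnion hM) using 1
  ext p
  simp only [mem_ofPred_eq, Set.mem_sdiff, mem_iUnion, mem_image, not_exists, not_and]
  refine and_congr_right fun _ => ⟨?_, ?_⟩
  · rintro h n q ⟨hq, hle⟩ rfl
    exact h q.1 (by have : 0 < 1 / ((n : ℝ) + 1) := by positivity
                    linarith) hq
  · intro h s hs hsD
    obtain ⟨n, hn⟩ := exists_nat_one_div_lt (sub_pos.2 hs)
    exact h n (s, p) ⟨hsD, by simp only; linarith⟩ rfl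

/-- Fubini: a vertical line contains at most one first hit. -/
theorem volume_firstHit {m : ℕ} {D : Set ((Fin m → ℝ) × ℝ)} (hD : IsClosed D) :
    volume {p ∈ D | ∀ s < p.2, (p.1, s) ∉ D} = 0 := by
  rw [Measure.volume_eq_prod, measure_prod_null (measurableSet_firstHit hD)]
  refine Eventually.of_forall fun z => Set.Subsingleton.measure_zero (fun s hs t ht => ?_) _
  by_contra hne
  rcases lt_or_gt_of_ne hne with h | h
  · exact ht.2 s h hs.1
  · exact hs.2 t h ht.1

/-- On `Fin (m + 1) → ℝ` the Hausdorff measure of dimension `m + 1` is Lebesgue measure, and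
Lipschitz maps preserve its null sets. -/
theorem hausdorffMeasure_image_eq_zero_of_volume {Y : Type*} [MetricSpace Y] [MeasurableSpace Y]
    [BorelSpace Y] {m : ℕ} {Z : Set ((Fin m → ℝ) × ℝ)} (hZ : volume Z = 0)
    {Φ : (Fin m → ℝ) × ℝ → Y} {K : ℝ≥0}
    (hΦ : LipschitzOnWith K Φ Z) : μH[(m + 1 : ℕ)] (Φ '' Z) = 0 := by
  let e := (MeasurableEquiv.piFinSuccAbove (fun _ : Fin (m + 1) => ℝ) 0).trans
    MeasurableEquiv.prodComm
  have he : MeasurePreserving e volume volume :=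
    Measure.measurePreserving_swap.comp (volume_preserving_piFinSuccAbove (fun _ => ℝ) 0)
  have hlip : LipschitzWith 1 e := by
    refine LipschitzWith.of_dist_le_mul fun x y => ?_
    rw [NNReal.coe_one, one_mul, Prod.dist_eq]
    refine max_le ((dist_pi_le_iff dist_nonneg).2 fun i => ?_) ?_
    · exact dist_le_pi_dist x y _
    · exact dist_le_pi_dist x y _
  have hpre : volume (e ⁻¹' Z) = 0 := by rw [he.measure_preimage_equiv, hZ]
  have hcard : (μH[(m + 1 : ℕ)] : Measure (Fin (m + 1) → ℝ)) = volume := by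
    rw [← hausdorffMeasure_pi_real, Fintype.card_fin]
  have hcomp : LipschitzOnWith (K * 1) (Φ ∘ e) (e ⁻¹' Z) :=
    hΦ.comp hlip.lipschitzOnWith fun x hx => hx
  have := hcomp.hausdorffMeasure_image_le (d := (m + 1 : ℕ)) (Nat.cast_nonneg _)
  rw [hcard, hpre, mul_zero, image_comp, image_preimage_eq _ e.surjective] at this
  exact le_antisymm this zero_le

/-- The points where the solutions starting in a rectifiable set `B` first hit a closed set. -/
theorem hausdorffMeasure_firstHit [FiniteDimensional ℝ E] [MeasurableSpace E] [BorelSpace E]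
    {V : E → E} {K : ℝ≥0} (hV : LipschitzWith K V) (x₀ : E) :
    ∃ r > 0, ∃ T > 0, ∀ {m : ℕ} {B : Set E}, LipRectifiable m B → ∀ {C : Set E}, IsClosed C →
      μH[(m + 1 : ℕ)] {y | ∃ (u : ℝ → E) (b : ℝ), 0 ≤ b ∧ b ≤ T ∧ IsSolutionOn V u 0 b ∧
        u 0 ∈ B ∧ u 0 ∈ Metric.closedBall x₀ r ∧ u b = y ∧ y ∈ C ∧ ∀ t ∈ Ico 0 b, u t ∉ C} = 0 := by
  -- `L` bounds the speed on the unit ball around `x₀`, and `L * T ≤ 1 / 2`: solutions starting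
  -- within `1 / 2` of `x₀` stay in that ball up to time `T`.
  set L : ℝ≥0 := ‖V x₀‖₊ + K with hL
  set T : ℝ := 1 / (2 * (L + 1)) with hT
  have hL1 : (0 : ℝ) < L + 1 := by positivity
  have hT0 : 0 < T := by positivity
  have hPL : IsPicardLindelof (fun _ => V) (tmin := 0) (tmax := T) ⟨0, le_rfl, hT0.le⟩ x₀ 1 (1 / 2)
      L K := by
    refine .of_time_independent (fun x hx => ?_) hV.lipschitzOnWith ?_
    · have h1 := hV.dist_le_mul x x₀
      have h2 : dist x x₀ ≤ 1 := by simpa using hx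
      rw [dist_eq_norm] at h1
      calc ‖V x‖ ≤ ‖V x - V x₀‖ + ‖V x₀‖ := norm_le_norm_sub_add _ _
        _ ≤ K * 1 + ‖V x₀‖ := by gcongr; exact h1.trans (by gcongr)
        _ = L := by rw [hL]; push_cast; ring
    · simp only [sub_zero, sub_self, max_eq_left hT0.le]
      rw [hT]
      field_simp
      push_cast
      have : (0 : ℝ) ≤ L := L.2
      linarith
  obtain ⟨α, hα, hαc⟩ := hPL.exists_forall_mem_closedBall_eq_hasDerivWithinAt_continuousOn
  set Q : Set E := Metric.closedBall x₀ ((1 / 2 : ℝ≥0) : ℝ) with hQ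
  have hsol : ∀ x ∈ Q, IsSolutionOn V (fun t => α (x, t)) 0 T := fun x hx =>
    ⟨fun t ht => ((hα x hx).2 t ht).continuousWithinAt,
      fun t ht => ((hα x hx).2 t (Ioo_subset_Icc_self ht)).hasDerivAt (Icc_mem_nhds ht.1 ht.2)⟩
  have hQc : IsCompact Q := isCompact_closedBall _ _
  obtain ⟨M, hM⟩ := (hQc.prod (isCompact_Icc (a := (0 : ℝ)) (b := T))).exists_bound_of_continuousOn
    (hV.continuous.comp_continuousOn hαc)
  have hM0 : 0 ≤ M := (norm_nonneg _).trans
    (hM (x₀, 0) ⟨Metric.mem_closedBall_self (NNReal.coe_nonneg _), le_rfl, hT0.le⟩)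
  have hαL : ∀ x ∈ Q, ∀ y ∈ Q, ∀ s ∈ Icc 0 T, ∀ t ∈ Icc 0 T,
      dist (α (x, s)) (α (y, t)) ≤ Real.exp (K * T) * dist x y + M * dist s t := by
    intro x hx y hy s hs t ht
    refine (dist_triangle _ (α (y, s)) _).trans (add_le_add ?_ ?_)
    · have h := (hsol x hx).dist_le (hsol y hy) hV hs
      have hx0 : α (x, 0) = x := (hα x hx).1
      have hy0 : α (y, 0) = y := (hα y hy).1
      rw [hx0, hy0] at h
      refine h.trans ?_
      rw [mul_comm]
      gcongr
      exact hs.2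
    · rcases le_total s t with h | h
      · rw [dist_comm, dist_comm s t, Real.dist_eq, abs_of_nonneg (sub_nonneg.2 h)]
        exact (hsol y hy).dist_time_le hV.continuous (fun t ht => hM (y, t) ⟨hy, ht⟩) hs.1 h ht.2
      · rw [Real.dist_eq, abs_of_nonneg (sub_nonneg.2 h)]
        exact (hsol y hy).dist_time_le hV.continuous (fun t ht => hM (y, t) ⟨hy, ht⟩) ht.1 h hs.2
  refine ⟨((1 / 2 : ℝ≥0) : ℝ), by norm_num, T, hT0, ?_⟩
  rintro m B ⟨𝒞, h𝒞, hB𝒞, hf⟩ C hC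
  have hcover : {y | ∃ (u : ℝ → E) (b : ℝ), 0 ≤ b ∧ b ≤ T ∧ IsSolutionOn V u 0 b ∧
        u 0 ∈ B ∧ u 0 ∈ Q ∧ u b = y ∧ y ∈ C ∧ ∀ t ∈ Ico 0 b, u t ∉ C} ⊆
      ⋃ A ∈ 𝒞, {y | ∃ (u : ℝ → E) (b : ℝ), 0 ≤ b ∧ b ≤ T ∧ IsSolutionOn V u 0 b ∧
        u 0 ∈ A ∧ u 0 ∈ Q ∧ u b = y ∧ y ∈ C ∧ ∀ t ∈ Ico 0 b, u t ∉ C} := by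
    rintro y ⟨u, b, h0, h1, h2, h3, h4⟩
    obtain ⟨A, hA, huA⟩ := hB𝒞 h3
    exact mem_iUnion₂.2 ⟨A, hA, u, b, h0, h1, h2, huA, h4⟩
  refine measure_mono_null hcover ((measure_biUnion_null_iff h𝒞).2 fun A hA => ?_)
  obtain ⟨K', f, s, hfs, rfl⟩ := hf A hA
  -- The parameter set `s` is arbitrary; extending `f` to all of `ℝ ^ m` makes the hitting set
  -- closed, at the harmless cost of more initial points.
  obtain ⟨g, hg, hfg⟩ := hfs.extend_finite_dimension
  set K'' := lipschitzExtensionConstant E * K'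
  have hX : IsClosed {p : (Fin m → ℝ) × ℝ | g p.1 ∈ Q ∧ p.2 ∈ Icc 0 T} :=
    (Metric.isClosed_closedBall.preimage (hg.continuous.comp continuous_fst)).inter
      (isClosed_Icc.preimage continuous_snd)
  set X := {p : (Fin m → ℝ) × ℝ | g p.1 ∈ Q ∧ p.2 ∈ Icc 0 T} with hXdef
  let Φ : (Fin m → ℝ) × ℝ → E := fun p => α (g p.1, p.2)
  have hΦ : LipschitzOnWith (Real.toNNReal (Real.exp (K * T) * K'' + M)) Φ X := by
    refine LipschitzOnWith.of_dist_le_mul fun p hp q hq => ?_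
    rw [Real.coe_toNNReal _ (by positivity)]
    refine (hαL _ hp.1 _ hq.1 _ hp.2 _ hq.2).trans ?_
    have h1 : dist (g p.1) (g q.1) ≤ K'' * dist p q :=
      (hg.dist_le_mul _ _).trans (by gcongr; exact le_max_left _ _)
    have h2 : dist p.2 q.2 ≤ dist p q := le_max_right _ _
    calc _ ≤ Real.exp (K * T) * (K'' * dist p q) + M * dist p q := by gcongr
      _ = _ := by ring
  have hD : IsClosed (X ∩ Φ ⁻¹' C) := hΦ.continuousOn.preimage_isClosed_of_isClosed hX hC
  refine measure_mono_null ?_ (hausdorffMeasure_image_eq_zero_of_volume (volume_firstHit hD)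
    (hΦ.mono fun p hp => hp.1.1))
  rintro y ⟨u, b, hb, hbT, hu, ⟨z, hz, hzu⟩, huQ, huy, hyC, hut⟩
  have hgz : g z = u 0 := by rw [← hfg hz, hzu]
  have hgzQ : g z ∈ Q := by rw [hgz]; exact huQ
  -- Uniqueness of solutions, as Grönwall's inequality with initial distance zero.
  have heq : ∀ t ∈ Icc 0 b, α (g z, t) = u t := by
    intro t ht
    have h := ((hsol _ hgzQ).mono le_rfl hbT).dist_le hu hV ht
    have h0 : α (g z, 0) = g z := (hα _ hgzQ).1
    rw [h0, hgz, dist_self, zero_mul] at h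
    rw [hgz]
    exact dist_le_zero.1 h
  refine ⟨(z, b), ⟨⟨⟨hgzQ, hb, hbT⟩, ?_⟩, ?_⟩, ?_⟩
  · change α (g z, b) ∈ C
    rwa [heq b ⟨hb, le_rfl⟩, huy]
  · rintro t ht ⟨⟨-, ht0⟩, htC⟩
    change α (g z, t) ∈ C at htC
    rw [heq t ⟨ht0.1, ht.le⟩] at htC
    exact hut t ⟨ht0.1, ht⟩ htC
  · exact (heq b ⟨hb, le_rfl⟩).trans huy

end FirstHit

/-! ### Rectifiable sets and trajectories in a manifold -/

section Manifold

variable {E : Type*} [NormedAddCommGroup E] [NormedSpace ℝ E]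
  {B : Type*} [TopologicalSpace B] (I : ModelWithCorners ℝ E B)
  {M : Type*} [TopologicalSpace M] [ChartedSpace B M]

/-- In every preferred chart, the set `A` is covered by countably many Lipschitz images of subsets
of `ℝ ^ m`. -/
def MRectifiable (m : ℕ) (A : Set M) : Prop :=
  ∀ x : M, LipRectifiable m (extChartAt I x '' (A ∩ (chartAt B x).source))

variable {I}

theorem MRectifiable.mono {m : ℕ} {A A' : Set M} (h : MRectifiable I m A') (hA : A ⊆ A') :
    MRectifiable I m A :=
  fun x => (h x).mono (image_mono (inter_subset_inter_left _ hA))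

theorem MRectifiable.iUnion {m : ℕ} {κ : Type*} [Countable κ] {A : κ → Set M}
    (h : ∀ i, MRectifiable I m (A i)) : MRectifiable I m (⋃ i, A i) := fun x => by
  rw [iUnion_inter, image_iUnion]
  exact .iUnion fun i => h i x

theorem MRectifiable.empty {m : ℕ} : MRectifiable I m (∅ : Set M) := fun x => by
  simpa using LipRectifiable.empty

/-- Coordinate changes are smooth on the convex set `range I`, hence locally Lipschitz. -/
theorem MRectifiable.of_chart [FiniteDimensional ℝ E] [IsManifold I ∞ M] {m : ℕ} {A : Set M}
    (x₀ : M) (hA : A ⊆ (chartAt B x₀).source) (h : LipRectifiable m (extChartAt I x₀ '' A)) :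
    MRectifiable I m A := fun x => by
  have h' := h.mono (image_mono (inter_subset_left (s := A) (t := (chartAt B x).source)))
  refine (h'.image_of_locally_lipschitzOn
    (g := extChartAt I x ∘ (extChartAt I x₀).symm) ?_).mono ?_
  · rintro _ ⟨p, ⟨hpA, hpx⟩, rfl⟩
    have hp0 : p ∈ (extChartAt I x₀).source := by rw [extChartAt_source]; exact hA hpA
    have hc : ContDiffWithinAt ℝ ∞ (extChartAt I x ∘ (extChartAt I x₀).symm) (range I)
        (extChartAt I x₀ p) := by
      refine contDiffWithinAt_ext_coord_change x x₀ ?_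
      rw [PartialEquiv.trans_source, PartialEquiv.symm_source]
      refine ⟨(extChartAt I x₀).map_source hp0, ?_⟩
      rw [mem_preimage, (extChartAt I x₀).left_inv hp0, extChartAt_source]
      exact hpx
    obtain ⟨K, t, ht, hK⟩ := (hc.of_le (by simp)).exists_lipschitzOnWith I.convex_range
    refine ⟨K, t, nhdsWithin_mono _ ?_ ht, hK⟩
    rintro _ ⟨q, -, rfl⟩
    exact mem_range_self _
  · rintro _ ⟨p, hp, rfl⟩
    refine ⟨_, ⟨p, hp, rfl⟩, ?_⟩
    rw [Function.comp_apply, (extChartAt I x₀).left_inv (by rw [extChartAt_source]; exact hA hp.1)]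

/-- The continuous curve `y` on `[a, b]` is an integral curve of `v` in the interior of the
interval. -/
structure IsTrajectory (v : ∀ p : M, TangentSpace I p) (y : ℝ → M) (a b : ℝ) : Prop where
  continuousOn : ContinuousOn y (Icc a b)
  hasMFDerivAt : ∀ t ∈ Ioo a b, HasMFDerivAt 𝓘(ℝ, ℝ) I y t ((1 : ℝ →L[ℝ] ℝ).smulRight (v (y t)))

variable {v : ∀ p : M, TangentSpace I p}

theorem IsTrajectory.mono {y : ℝ → M} {a b a' b' : ℝ} (h : IsTrajectory v y a b) (ha : a ≤ a')
    (hb : b' ≤ b) : IsTrajectory v y a' b' :=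
  ⟨h.continuousOn.mono (Icc_subset_Icc ha hb),
    fun t ht => h.hasMFDerivAt t (Ioo_subset_Ioo ha hb ht)⟩

/-- On the open set `N`, the Lipschitz field `V` represents the vector field `v` in the chart at
`x₀`. -/
structure IsFlowBox (v : ∀ p : M, TangentSpace I p) (x₀ : M) (N : Set M) (K : ℝ≥0) (V : E → E) :
    Prop where
  isOpen : IsOpen N
  subset : N ⊆ (chartAt B x₀).source
  lipschitz : LipschitzWith K V
  eq : ∀ p ∈ N, V (extChartAt I x₀ p) = mfderiv I 𝓘(ℝ, E) (extChartAt I x₀) p (v p)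

theorem IsFlowBox.inter {x₀ : M} {N O : Set M} {K : ℝ≥0} {V : E → E} (h : IsFlowBox v x₀ N K V)
    (hO : IsOpen O) : IsFlowBox v x₀ (N ∩ O) K V :=
  ⟨h.isOpen.inter hO, inter_subset_left.trans h.subset, h.lipschitz, fun p hp => h.eq p hp.1⟩

/-- The coordinate expression of `v` is smooth within `range I`, so it is Lipschitz near the point.
Extending it to a Lipschitz field on all of `E` allows the usual theory of differential equations
even at boundary points. -/
theorem exists_isFlowBox [FiniteDimensional ℝ E] [IsManifold I ∞ M]
    (hv : ContMDiff I I.tangent ∞ (fun p : M => (⟨p, v p⟩ : TangentBundle I M))) (x₀ : M) :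
    ∃ N K V, x₀ ∈ N ∧ IsFlowBox v x₀ N K V := by
  have : IsManifold I 1 M := IsManifold.of_le (n := ∞) (by simp)
  have h1 := (Bundle.contMDiffAt_section (s := v) x₀).1 (hv x₀)
  have h2 := ((contMDiffAt_iff.1 h1).2.of_le (m := 1) (by simp)).exists_lipschitzOnWith
    I.convex_range
  obtain ⟨K, t, ht, hK⟩ := h2
  obtain ⟨V, hV, hVt⟩ := hK.extend_finite_dimension
  obtain ⟨o, ho, hxo, hot⟩ := mem_nhdsWithin.1 ht
  refine ⟨(chartAt B x₀).source ∩ extChartAt I x₀ ⁻¹' o, _, V, ⟨mem_chart_source _ _, hxo⟩,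
    ?_, inter_subset_left, hV, ?_⟩
  · exact isOpen_extChartAt_preimage x₀ ho
  · intro p hp
    have hp0 : p ∈ (extChartAt I x₀).source := by rw [extChartAt_source]; exact hp.1
    have h3 : (trivializationAt E (TangentSpace I) x₀ ⟨p, v p⟩).2 =
        (trivializationAt E (TangentSpace I) x₀).continuousLinearMapAt ℝ p (v p) := by
      rw [Bundle.Trivialization.continuousLinearMapAt_apply,
        Bundle.Trivialization.linearMapAt_apply, if_pos]
      simpa using hp.1
    have h4 := hVt (hot ⟨hp.2, mem_range_self (chartAt B x₀ p)⟩)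
    rw [TangentBundle.continuousLinearMapAt_trivializationAt hp.1] at h3
    refine h4.symm.trans (Eq.trans ?_ h3)
    change (trivializationAt E (TangentSpace I) x₀ ⟨(extChartAt I x₀).symm (extChartAt I x₀ p),
      v ((extChartAt I x₀).symm (extChartAt I x₀ p))⟩).2 = _
    rw [(extChartAt I x₀).left_inv hp0]

theorem IsFlowBox.isSolutionOn [IsManifold I ∞ M] {x₀ : M} {N : Set M} {K : ℝ≥0} {V : E → E}
    (h : IsFlowBox v x₀ N K V) {y : ℝ → M} {a b : ℝ} (hy : IsTrajectory v y a b)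
    (hN : ∀ t ∈ Icc a b, y t ∈ N) : IsSolutionOn V (extChartAt I x₀ ∘ y) a b := by
  have : IsManifold I 1 M := IsManifold.of_le (n := ∞) (by simp)
  refine ⟨(continuousOn_extChartAt x₀).comp hy.continuousOn fun t ht => ?_, fun t ht => ?_⟩
  · rw [extChartAt_source]
    exact h.subset (hN t ht)
  · have htN := hN t (Ioo_subset_Icc_self ht)
    have h1 := (mdifferentiableAt_extChartAt (I := I) (h.subset htN)).hasMFDerivAt.comp t
      (hy.hasMFDerivAt t ht)
    let D : E →L[ℝ] E := mfderiv I 𝓘(ℝ, E) (extChartAt I x₀) (y t)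
    let w : E := v (y t)
    have h2 : HasFDerivAt (extChartAt I x₀ ∘ y) (D.comp ((1 : ℝ →L[ℝ] ℝ).smulRight w)) t :=
      h1.hasFDerivAt
    have h3 : V (extChartAt I x₀ (y t)) = D ((1 : ℝ) • w) := by
      rw [one_smul]
      exact h.eq _ htN
    rw [Function.comp_apply, h3]
    exact h2.hasDerivAt

theorem IsFlowBox.isSolutionOn_shift [IsManifold I ∞ M] {x₀ : M} {N : Set M} {K : ℝ≥0} {V : E → E}
    (h : IsFlowBox v x₀ N K V) {y : ℝ → M} {a b : ℝ} (hy : IsTrajectory v y a b)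
    (hN : ∀ t ∈ Icc a b, y t ∈ N) :
    IsSolutionOn V (fun s => extChartAt I x₀ (y (a + s))) 0 (b - a) := by
  have := h.isSolutionOn hy hN
  exact IsSolutionOn.comp_const_add (u := extChartAt I x₀ ∘ y) (by simpa using this)

end Manifold

/-! ### Relations that are Lipschitz in charts -/

section Relations

variable {E : Type*} [NormedAddCommGroup E] [NormedSpace ℝ E]
  {B : Type*} [TopologicalSpace B] (I : ModelWithCorners ℝ E B)
  {M : Type*} [TopologicalSpace M] [ChartedSpace B M]
  {E' : Type*} [NormedAddCommGroup E'] [NormedSpace ℝ E']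
  {B' : Type*} [TopologicalSpace B'] (I' : ModelWithCorners ℝ E' B')
  {M' : Type*} [TopologicalSpace M'] [ChartedSpace B' M']

/-- In the charts at some points `x` and `x'`, the relation `ρ` is the graph of a Lipschitz map. -/
def IsChartLipschitz (ρ : M → M' → Prop) : Prop :=
  ∃ (x : M) (x' : M') (C : ℝ≥0),
    (∀ p q, ρ p q → p ∈ (chartAt B x).source ∧ q ∈ (chartAt B' x').source) ∧
    ∀ p q p' q', ρ p q → ρ p' q' →
      dist (extChartAt I' x' q) (extChartAt I' x' q') ≤
        C * dist (extChartAt I x p) (extChartAt I x p')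

variable {I I'}

theorem MRectifiable.image_rel [FiniteDimensional ℝ E'] [IsManifold I' ∞ M'] {m : ℕ} {A : Set M}
    (hA : MRectifiable I m A) {ρ : M → M' → Prop} (hρ : IsChartLipschitz I I' ρ) :
    MRectifiable I' m {q | ∃ p ∈ A, ρ p q} := by
  obtain ⟨x, x', C, hs, hC⟩ := hρ
  refine .of_chart x' (fun q ⟨p, _, hpq⟩ => (hs p q hpq).2) ?_
  refine ((hA x).image_rel (r := fun a b => ∃ p q, ρ p q ∧ extChartAt I x p = a ∧
    extChartAt I' x' q = b) (C := C) ?_).mono ?_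
  · rintro _ _ _ _ ⟨p, q, h, rfl, rfl⟩ ⟨p', q', h', rfl, rfl⟩
    exact hC _ _ _ _ h h'
  · rintro _ ⟨q, ⟨p, hpA, hpq⟩, rfl⟩
    exact ⟨_, ⟨p, ⟨hpA, (hs p q hpq).1⟩, rfl⟩, p, q, hpq, rfl, rfl⟩

variable {v : ∀ p : M, TangentSpace I p}

/-- Following a trajectory inside `N` for the time `T`. -/
def FlowRel (v : ∀ p : M, TangentSpace I p) (N : Set M) (T : ℝ) (p q : M) : Prop :=
  ∃ (y : ℝ → M) (a : ℝ), IsTrajectory v y a (a + T) ∧ (∀ t ∈ Icc a (a + T), y t ∈ N) ∧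
    y a = p ∧ y (a + T) = q

/-- Following a trajectory inside `N` for a time at most `1` up to a point of `G`. -/
def HitRel (v : ∀ p : M, TangentSpace I p) (N G : Set M) (p q : M) : Prop :=
  q ∈ G ∧ ∃ (y : ℝ → M) (a b : ℝ), a ≤ b ∧ b ≤ a + 1 ∧ IsTrajectory v y a b ∧
    (∀ t ∈ Icc a b, y t ∈ N) ∧ y a = p ∧ y b = q

/-- Grönwall's inequality for a fixed time `T`. -/
theorem IsFlowBox.isChartLipschitz_flowRel [IsManifold I ∞ M] {x₀ : M} {N : Set M} {K : ℝ≥0}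
    {V : E → E} (h : IsFlowBox v x₀ N K V) {T : ℝ} (hT : 0 ≤ T) :
    IsChartLipschitz I I (FlowRel v N T) := by
  refine ⟨x₀, x₀, Real.toNNReal (Real.exp (K * T)), ?_, ?_⟩
  · rintro p q ⟨y, a, hy, hN, rfl, rfl⟩
    exact ⟨h.subset (hN _ ⟨le_rfl, by linarith⟩), h.subset (hN _ ⟨by linarith, le_rfl⟩)⟩
  · rintro p q p' q' ⟨y, a, hy, hN, rfl, rfl⟩ ⟨y', a', hy', hN', rfl, rfl⟩
    have h1 := h.isSolutionOn_shift hy hN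
    have h2 := h.isSolutionOn_shift hy' hN'
    rw [add_sub_cancel_left] at h1 h2
    have := h1.dist_le h2 h.lipschitz (t := T) ⟨hT, le_rfl⟩
    rw [mul_comm] at this
    rw [Real.coe_toNNReal _ (Real.exp_pos _).le]
    simpa using this

/-- This is `IsSolutionOn.dist_end_le` in the chart. The time bound `1` in `HitRel` keeps the
constant uniform; `key` treats the case where the first trajectory is the shorter one, and symmetry
does the rest. -/
theorem IsFlowBox.isChartLipschitz_hitRel [IsManifold I ∞ M] {x₀ : M} {N G : Set M} {K : ℝ≥0}
    {V : E → E} (h : IsFlowBox v x₀ N K V) (ℓ : E →L[ℝ] ℝ) {L k : ℝ} (hk : 0 < k)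
    (hL : ∀ p ∈ N, ‖V (extChartAt I x₀ p)‖ ≤ L) (hl : ∀ p ∈ N, ℓ (V (extChartAt I x₀ p)) ≤ -k)
    (hG : ∀ p ∈ N, p ∈ G → ℓ (extChartAt I x₀ p) = 0) :
    IsChartLipschitz I I (HitRel v N G) := by
  refine ⟨x₀, x₀, Real.toNNReal (Real.exp K * (1 + L * ‖ℓ‖ / k)), ?_, ?_⟩
  · rintro p q ⟨-, y, a, b, hab, -, hy, hN, rfl, rfl⟩
    exact ⟨h.subset (hN _ ⟨le_rfl, hab⟩), h.subset (hN _ ⟨hab, le_rfl⟩)⟩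
  · have key : ∀ p q p' q' y a b y' a' b', q ∈ G → q' ∈ G → a ≤ b → b' ≤ a' + 1 →
        b - a ≤ b' - a' → IsTrajectory v y a b → (∀ t ∈ Icc a b, y t ∈ N) → y a = p → y b = q →
        IsTrajectory v y' a' b' → (∀ t ∈ Icc a' b', y' t ∈ N) → y' a' = p' → y' b' = q' →
        dist (extChartAt I x₀ q) (extChartAt I x₀ q') ≤
          Real.toNNReal (Real.exp K * (1 + L * ‖ℓ‖ / k)) *
            dist (extChartAt I x₀ p) (extChartAt I x₀ p') := by
      rintro p q p' q' y a b y' a' b' hq hq' hab hb' hle hy hN rfl rfl hy' hN' rfl rfl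
      have h1 := h.isSolutionOn_shift hy hN
      have h2 := h.isSolutionOn_shift hy' hN'
      have hN'' : ∀ t ∈ Icc 0 (b' - a'), y' (a' + t) ∈ N := fun t ht =>
        hN' _ ⟨by linarith [ht.1], by linarith [ht.2]⟩
      have := IsSolutionOn.dist_end_le h.lipschitz ℓ (L := L) hk (sub_nonneg.2 hab)
        (by linarith) hle h1 h2 (fun t ht => hL _ (hN'' t ht)) (fun t ht => hl _ (hN'' t ht))
        (by simpa using hG _ (hN _ ⟨hab, le_rfl⟩) hq)
        (by simpa using hG _ (hN' _ ⟨by linarith, le_rfl⟩) hq')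
      have hL0 : 0 ≤ L := (norm_nonneg _).trans (hL _ (hN _ ⟨hab, le_rfl⟩))
      rw [Real.coe_toNNReal _ (by positivity)]
      simpa using this
    rintro p q p' q' ⟨hq, y, a, b, hab, hb, hy, hN, hp, hyq⟩
      ⟨hq', y', a', b', hab', hb', hy', hN', hp', hyq'⟩
    rcases le_total (b - a) (b' - a') with hle | hle
    · exact key p q p' q' y a b y' a' b' hq hq' hab hb' hle hy hN hp hyq hy' hN' hp' hyq'
    · rw [dist_comm, dist_comm (extChartAt I x₀ p)]
      exact key p' q' p q y' a' b' y a b hq' hq hab' hb hle hy' hN' hp' hyq' hy hN hp hyq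

end Relations

/-! ### Manifolds modelled on the half-space -/

section HalfSpace

theorem Submodule.lipRectifiable {E : Type*} [NormedAddCommGroup E] [NormedSpace ℝ E]
    [FiniteDimensional ℝ E] (W : Submodule ℝ E) {m : ℕ} (hW : Module.finrank ℝ W = m) :
    LipRectifiable m (W : Set E) := by
  have e : (Fin m → ℝ) ≃L[ℝ] W := ContinuousLinearEquiv.ofFinrankEq (by simp [hW])
  let f : (Fin m → ℝ) →L[ℝ] E := W.subtypeL.comp e.toContinuousLinearMap
  have := LipRectifiable.image_of_lipschitzOnWith (f.lipschitz.lipschitzOnWith (s := univ))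
  refine this.mono fun x hx => ⟨e.symm ⟨x, hx⟩, mem_univ _, ?_⟩
  simp [f]

variable {n : ℕ} [NeZero n]

theorem lipRectifiable_hyperplane :
    LipRectifiable (n - 1) {u : EuclideanSpace ℝ (Fin n) | u 0 = 0} := by
  let ℓ : EuclideanSpace ℝ (Fin n) →L[ℝ] ℝ := EuclideanSpace.proj 0
  have hne : (ℓ : Module.Dual ℝ (EuclideanSpace ℝ (Fin n))) ≠ 0 := fun h => by
    have := LinearMap.congr_fun h (EuclideanSpace.single 0 1)
    simp [ℓ] at this
  have hf := Module.Dual.finrank_ker_add_one_of_ne_zero hne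
  rw [finrank_euclideanSpace_fin] at hf
  exact Submodule.lipRectifiable (LinearMap.ker (ℓ : Module.Dual ℝ (EuclideanSpace ℝ (Fin n))))
    (by omega)

variable {M : Type*} [TopologicalSpace M] [ChartedSpace (EuclideanHalfSpace n) M]

theorem extChartAt_halfSpace_nonneg (x p : M) : 0 ≤ extChartAt (𝓡∂ n) x p 0 := by
  have : extChartAt (𝓡∂ n) x p ∈ range (𝓡∂ n) := mem_range_self (chartAt _ x p)
  rwa [range_modelWithCornersEuclideanHalfSpace] at this

variable [IsManifold (𝓡∂ n) ∞ M]

theorem mem_boundary_iff_extChartAt {x p : M} (hp : p ∈ (chartAt (EuclideanHalfSpace n) x).source) :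
    p ∈ (𝓡∂ n).boundary M ↔ extChartAt (𝓡∂ n) x p 0 = 0 := by
  have h1 : (𝓡∂ n).IsInteriorPoint p ↔ 0 < extChartAt (𝓡∂ n) x p 0 := by
    rw [ModelWithCorners.isInteriorPoint_iff_of_mem_atlas (n := ∞) (by simp)
      (chart_mem_atlas _ x) hp]
    have h2 : extChartAt (𝓡∂ n) x p ∈ interior (range (𝓡∂ n)) ↔ 0 < extChartAt (𝓡∂ n) x p 0 := by
      rw [interior_range_modelWithCornersEuclideanHalfSpace]
      exact Iff.rfl
    rw [← h2]
    exact ⟨fun h => interior_mono (extChartAt_target_subset_range x) h,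
      fun h => OpenPartialHomeomorph.mem_interior_extend_target _
        ((chartAt _ x).map_source hp) h⟩
  change (𝓡∂ n).IsBoundaryPoint p ↔ _
  rw [ModelWithCorners.isBoundaryPoint_iff_not_isInteriorPoint, h1, not_lt]
  exact ⟨fun h => le_antisymm h (extChartAt_halfSpace_nonneg x p), fun h => h.le⟩

theorem mRectifiable_boundary : MRectifiable (𝓡∂ n) (n - 1) ((𝓡∂ n).boundary M) := fun x => by
  refine lipRectifiable_hyperplane.mono ?_
  rintro _ ⟨p, hp, rfl⟩
  exact (mem_boundary_iff_extChartAt hp.2).1 hp.1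

/-- Around a boundary point where the field points outwards, the trajectories hit the boundary in a
Lipschitz way. -/
theorem exists_isChartLipschitz_hitRel {v : ∀ p : M, TangentSpace (𝓡∂ n) p}
    (hv : ContMDiff (𝓡∂ n) (𝓡∂ n).tangent ∞
      (fun p : M => (⟨p, v p⟩ : TangentBundle (𝓡∂ n) M))) {x₀ : M}
    (hx₀ : (show EuclideanSpace ℝ (Fin n) from mfderiv (𝓡∂ n) 𝓘(ℝ, EuclideanSpace ℝ (Fin n))
      (extChartAt (𝓡∂ n) x₀) x₀ (v x₀)) 0 < 0)
    {G : Set M} (hG : G ⊆ (𝓡∂ n).boundary M) :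
    ∃ N, IsOpen N ∧ x₀ ∈ N ∧ IsChartLipschitz (𝓡∂ n) (𝓡∂ n) (HitRel v N G) := by
  obtain ⟨N, K, V, hxN, hbox⟩ := exists_isFlowBox hv x₀
  let ℓ : EuclideanSpace ℝ (Fin n) →L[ℝ] ℝ := EuclideanSpace.proj 0
  set w := extChartAt (𝓡∂ n) x₀ x₀ with hw
  have hk : ℓ (V w) < 0 := by
    rw [hw, hbox.eq x₀ hxN]
    exact hx₀
  set k := -ℓ (V w) / 2 with hkdef
  have hk0 : 0 < k := by rw [hkdef]; linarith
  have hVc := hbox.lipschitz.continuous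
  have hO : IsOpen {u | ‖V u‖ < ‖V w‖ + 1 ∧ ℓ (V u) < -k} :=
    (isOpen_lt hVc.norm continuous_const).inter
      (isOpen_lt (ℓ.continuous.comp hVc) continuous_const)
  have hO' := isOpen_extChartAt_preimage (I := 𝓡∂ n) x₀ hO
  have hbox' := hbox.inter hO'
  refine ⟨_, hbox'.isOpen, ⟨hxN, mem_chart_source _ _, ?_⟩,
    hbox'.isChartLipschitz_hitRel ℓ (L := ‖V w‖ + 1) hk0 (fun p hp => hp.2.2.1.le)
      (fun p hp => hp.2.2.2.le) fun p hp hpG => (mem_boundary_iff_extChartAt hp.2.1).1 (hG hpG)⟩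
  refine ⟨?_, ?_⟩
  · linarith
  · change ℓ (V w) < -k
    rw [hkdef]
    linarith

variable {E' : Type*} [NormedAddCommGroup E'] [NormedSpace ℝ E']
  {B' : Type*} [TopologicalSpace B'] {I' : ModelWithCorners ℝ E' B'}
  {M' : Type*} [TopologicalSpace M'] [ChartedSpace B' M']

/-- A map that is smooth on a relatively open part `G` of the boundary is locally Lipschitz in
charts. -/
theorem exists_isChartLipschitz_of_contMDiffWithinAt {G O : Set M} (hO : IsOpen O)
    (hG : G = O ∩ (𝓡∂ n).boundary M) {p : M} (hp : p ∈ G) {r : M → M'}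
    (hr : ContMDiffWithinAt (𝓡∂ n) I' ∞ r G p) :
    ∃ N, IsOpen N ∧ p ∈ N ∧ IsChartLipschitz (𝓡∂ n) I' fun a b => a ∈ N ∧ a ∈ G ∧ r a = b := by
  obtain ⟨hc, hd⟩ := contMDiffWithinAt_iff.1 hr
  set φ := extChartAt (𝓡∂ n) p with hφ
  set P : Set (EuclideanSpace ℝ (Fin n)) := {u | u 0 = 0} with hP
  have hPc : Convex ℝ P :=
    (LinearMap.ker (EuclideanSpace.proj 0 : EuclideanSpace ℝ (Fin n) →L[ℝ] ℝ).toLinearMap).convex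
  -- The chart image of `G` need not be convex, but near `φ p` it fills the hyperplane `P`, which
  -- is; a Lipschitz bound can therefore be taken within `P`.
  have hmem : φ.symm ⁻¹' G ∩ range (𝓡∂ n) ∈ 𝓝[P] (φ p) := by
    have hPr : P ⊆ range (𝓡∂ n) := by
      rw [range_modelWithCornersEuclideanHalfSpace]
      exact fun u hu => (show u 0 = 0 from hu).ge
    have h1 : φ.target ∈ 𝓝[P] (φ p) := nhdsWithin_mono _ hPr (extChartAt_target_mem_nhdsWithin p)
    have h2 : φ.symm ⁻¹' O ∈ 𝓝[P] (φ p) := by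
      refine mem_nhdsWithin_of_mem_nhds ((continuousAt_extChartAt_symm p).preimage_mem_nhds ?_)
      rw [extChartAt_to_inv]
      exact hO.mem_nhds (by rw [hG] at hp; exact hp.1)
    filter_upwards [h1, h2, self_mem_nhdsWithin] with u hu1 hu2 hu3
    refine ⟨?_, hPr hu3⟩
    rw [hG]
    refine ⟨hu2, ?_⟩
    have hs : φ.symm u ∈ (chartAt (EuclideanHalfSpace n) p).source := by
      rw [← extChartAt_source (𝓡∂ n)]
      exact φ.map_target hu1
    rw [mem_boundary_iff_extChartAt hs, ← hφ, φ.right_inv hu1]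
    exact hu3
  have hd' := (hd.mono_of_mem_nhdsWithin hmem).of_le (m := 1) (by simp)
  obtain ⟨K, t, ht, hK⟩ := hd'.exists_lipschitzOnWith hPc
  obtain ⟨o, ho, hpo, hot⟩ := mem_nhdsWithin.1 ht
  obtain ⟨o', ho', hpo', hot'⟩ := mem_nhdsWithin.1
    (hc.preimage_mem_nhdsWithin (chart_source_mem_nhds B' (r p)))
  refine ⟨((chartAt (EuclideanHalfSpace n) p).source ∩ φ ⁻¹' o) ∩ o',
    (isOpen_extChartAt_preimage p ho).inter ho', ⟨⟨mem_chart_source _ _, hpo⟩, hpo'⟩,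
    p, r p, K, ?_, ?_⟩
  · rintro a _ ⟨ha, haG, rfl⟩
    exact ⟨ha.1.1, hot' ⟨ha.2, haG⟩⟩
  · rintro a _ a' _ ⟨ha, haG, rfl⟩ ⟨ha', haG', rfl⟩
    have hmemt : ∀ a, a ∈ ((chartAt (EuclideanHalfSpace n) p).source ∩ φ ⁻¹' o) ∩ o' → a ∈ G →
        φ a ∈ t ∧ φ.symm (φ a) = a := fun a ha haG =>
      ⟨hot ⟨ha.1.2, (mem_boundary_iff_extChartAt ha.1.1).1 (by rw [hG] at haG; exact haG.2)⟩,
        φ.left_inv (by rw [hφ, extChartAt_source]; exact ha.1.1)⟩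
    have := hK.dist_le_mul _ (hmemt a ha haG).1 _ (hmemt a' ha' haG').1
    simp only [Function.comp_apply, (hmemt a ha haG).2, (hmemt a' ha' haG').2] at this
    exact this

end HalfSpace

namespace HybridSystem

variable {J : Type u} (H : HybridSystem.{u, v} J)

/-! ### The states reachable from the guard of one domain -/

/-- The part of `A` in each domain is rectifiable. -/
def StateRectifiable (m : ℕ) (A : Set H.State) : Prop :=
  ∀ k, MRectifiable (𝓡∂ (H.dim k)) m {p : H.D k | (⟨k, p⟩ : H.State) ∈ A}

/-- A relation between two domains, as a relation on the total space. -/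
def liftRel {j k : J} (ρ : H.D j → H.D k → Prop) (a b : H.State) : Prop :=
  ∃ p q, a = ⟨j, p⟩ ∧ b = ⟨k, q⟩ ∧ ρ p q

/-- A relation on the total space that relates two domains only and is Lipschitz in charts. -/
def IsStateLipschitz (σ : H.State → H.State → Prop) : Prop :=
  ∃ (j k : J) (ρ : H.D j → H.D k → Prop),
    IsChartLipschitz (𝓡∂ (H.dim j)) (𝓡∂ (H.dim k)) ρ ∧ σ = H.liftRel ρ

/-- The set `W` is closed under the relations in `𝓕`. -/
def IsClosedUnder (𝓕 : Set (H.State → H.State → Prop)) (W : Set H.State) : Prop :=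
  ∀ σ ∈ 𝓕, ∀ a b, a ∈ W → σ a b → b ∈ W

/-- Some countable family of relations that are Lipschitz in charts is such that every set closed
under it has the property `Q`. -/
def IsGeneratedProperty (Q : Set H.State → Prop) : Prop :=
  ∃ 𝓕 : Set (H.State → H.State → Prop), 𝓕.Countable ∧ (∀ σ ∈ 𝓕, H.IsStateLipschitz σ) ∧
    ∀ W, H.IsClosedUnder 𝓕 W → Q W

variable {H}

theorem StateRectifiable.image_rel {m : ℕ} {A : Set H.State} (hA : H.StateRectifiable m A)
    {σ : H.State → H.State → Prop} (hσ : H.IsStateLipschitz σ) :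
    H.StateRectifiable m {b | ∃ a ∈ A, σ a b} := by
  obtain ⟨j, k, ρ, hρ, rfl⟩ := hσ
  intro k'
  by_cases hk : k = k'
  · subst hk
    refine ((hA j).image_rel hρ).mono ?_
    rintro q ⟨a, ha, p, q', rfl, hq, hpq⟩
    obtain rfl := eq_of_heq (Sigma.mk.inj hq).2
    exact ⟨p, ha, hpq⟩
  · refine MRectifiable.empty.mono ?_
    rintro q ⟨a, ha, p, q', rfl, hq, hpq⟩
    exact hk (Sigma.mk.inj hq).1.symm

theorem StateRectifiable.iUnion {m : ℕ} {κ : Type*} [Countable κ] {A : κ → Set H.State}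
    (hA : ∀ i, H.StateRectifiable m (A i)) : H.StateRectifiable m (⋃ i, A i) := fun k =>
  (MRectifiable.iUnion fun i => hA i k).mono fun p hp => by
    obtain ⟨i, hi⟩ := mem_iUnion.1 hp
    exact mem_iUnion.2 ⟨i, hi⟩

/-- Iterate the union of all one-step images; countability of `𝓕` keeps every stage, and the union
of the stages, rectifiable. -/
theorem StateRectifiable.exists_isClosedUnder {m : ℕ} {A : Set H.State}
    (hA : H.StateRectifiable m A) {𝓕 : Set (H.State → H.State → Prop)} (h𝓕 : 𝓕.Countable)
    (hL : ∀ σ ∈ 𝓕, H.IsStateLipschitz σ) :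
    ∃ W, A ⊆ W ∧ H.StateRectifiable m W ∧ H.IsClosedUnder 𝓕 W := by
  have := h𝓕.to_subtype
  let step : Set H.State → Set H.State := fun A => ⋃ σ : 𝓕, {b | ∃ a ∈ A, σ.1 a b}
  have hstep : ∀ n, H.StateRectifiable m (step^[n] A) := by
    intro n
    induction n with
    | zero => exact hA
    | succ n ih =>
      rw [Function.iterate_succ_apply']
      exact .iUnion fun σ => ih.image_rel (hL σ.1 σ.2)
  refine ⟨⋃ n, step^[n] A, subset_iUnion (fun n => step^[n] A) 0, .iUnion hstep, ?_⟩
  intro σ hσ a b ha hab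
  obtain ⟨n, hn⟩ := mem_iUnion.1 ha
  refine mem_iUnion.2 ⟨n + 1, ?_⟩
  rw [Function.iterate_succ_apply']
  exact mem_iUnion.2 ⟨⟨σ, hσ⟩, a, hn, hab⟩

theorem IsGeneratedProperty.forall {κ : Type*} [Countable κ] {Q : κ → Set H.State → Prop}
    (h : ∀ i, H.IsGeneratedProperty (Q i)) : H.IsGeneratedProperty fun W => ∀ i, Q i W := by
  choose 𝓕 h1 h2 h3 using h
  refine ⟨⋃ i, 𝓕 i, countable_iUnion h1, fun σ hσ => ?_, fun W hW i => h3 i W fun σ hσ =>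
    hW σ (mem_iUnion.2 ⟨i, hσ⟩)⟩
  obtain ⟨i, hi⟩ := mem_iUnion.1 hσ
  exact h2 i σ hi

theorem IsGeneratedProperty.and {Q Q' : Set H.State → Prop}
    (h : H.IsGeneratedProperty Q) (h' : H.IsGeneratedProperty Q') :
    H.IsGeneratedProperty fun W => Q W ∧ Q' W := by
  obtain ⟨𝓕, h1, h2, h3⟩ := h
  obtain ⟨𝓕', h1', h2', h3'⟩ := h'
  exact ⟨𝓕 ∪ 𝓕', h1.union h1', fun σ hσ => hσ.elim (h2 σ) (h2' σ), fun W hW =>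
    ⟨h3 W fun σ hσ => hW σ (Or.inl hσ), h3' W fun σ hσ => hW σ (Or.inr hσ)⟩⟩

theorem IsGeneratedProperty.mono {Q Q' : Set H.State → Prop}
    (h : H.IsGeneratedProperty Q) (hQ : ∀ W, Q W → Q' W) : H.IsGeneratedProperty Q' := by
  obtain ⟨𝓕, h1, h2, h3⟩ := h
  exact ⟨𝓕, h1, h2, fun W hW => hQ W (h3 W hW)⟩

/-! ### Closure under rational-time flow, guard hits and resets -/

variable (H)

/-- Trajectories that start in `W` are in `W` at all later times that differ from the initial time
by a rational number. -/
def FlowClosed (k : J) (W : Set H.State) : Prop :=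
  ∀ (y : ℝ → H.D k) (a b : ℝ), IsTrajectory (H.F k) y a b → (⟨k, y a⟩ : H.State) ∈ W →
    ∀ q : ℚ, 0 ≤ q → a + q < b → (⟨k, y (a + q)⟩ : H.State) ∈ W

/-- Trajectories that start in `W` reach the guard in `W`. -/
def HitClosed (k : J) (W : Set H.State) : Prop :=
  ∀ (y : ℝ → H.D k) (a b : ℝ), a ≤ b → IsTrajectory (H.F k) y a b → (⟨k, y a⟩ : H.State) ∈ W →
    y b ∈ H.G k → (⟨k, y b⟩ : H.State) ∈ W

/-- The relations are flows of rational duration inside countably many flow boxes covering `D k`. A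
long trajectory is a chain of such pieces, obtained by continuous induction along `[a, b]`. -/
theorem isGeneratedProperty_flowClosed (k : J) : H.IsGeneratedProperty (H.FlowClosed k) := by
  choose N K V hxN hbox using exists_isFlowBox (H.smooth_F k)
  obtain ⟨c, hc, hcover⟩ := TopologicalSpace.countable_cover_nhds
    fun x => (hbox x).isOpen.mem_nhds (hxN x)
  refine ⟨⋃ x ∈ c, range fun q : {q : ℚ // 0 ≤ q} => H.liftRel (FlowRel (H.F k) (N x) (q.1 : ℝ)),
    hc.biUnion fun x _ => countable_range _, ?_, ?_⟩
  · intro σ hσ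
    obtain ⟨x, hx, q, rfl⟩ := mem_iUnion₂.1 hσ
    exact ⟨k, k, _, (hbox x).isChartLipschitz_flowRel (by exact_mod_cast q.2), rfl⟩
  intro W hW y a b hy hya
  have hrel : ∀ x ∈ c, ∀ q : ℚ, 0 ≤ q → ∀ p p', (⟨k, p⟩ : H.State) ∈ W →
      FlowRel (H.F k) (N x) q p p' → (⟨k, p'⟩ : H.State) ∈ W := fun x hx q hq p p' hp hpp' =>
    hW _ (mem_iUnion₂.2 ⟨x, hx, ⟨q, hq⟩, rfl⟩) _ _ hp ⟨p, p', rfl, rfl, hpp'⟩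
  rcases lt_or_ge b a with hba | hab
  · intro q hq hqb
    have : (0 : ℝ) ≤ q := by exact_mod_cast hq
    linarith
  -- The strict inequality makes `s` closed, as continuous induction requires.
  let s : Set ℝ := {t | ∀ q : ℚ, 0 ≤ q → a + q < t → (⟨k, y (a + q)⟩ : H.State) ∈ W}
  suffices h : Icc a b ⊆ s from h (right_mem_Icc.2 hab)
  have hs : IsClosed s := by
    have : s = ⋂ q : {q : ℚ // 0 ≤ q ∧ (⟨k, y (a + q)⟩ : H.State) ∉ W}, Iic (a + (q.1 : ℝ)) := by
      ext t
      simp only [mem_iInter, mem_Iic, Subtype.forall, s, mem_ofPred_eq]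
      refine forall_congr' fun q => ⟨fun h hq => ?_, fun h hq ht => ?_⟩
      · by_contra hlt
        exact hq.2 (h hq.1 (not_le.1 hlt))
      · by_contra hW'
        exact absurd (h ⟨hq, hW'⟩) (not_le.2 ht)
    rw [this]
    exact isClosed_iInter fun q => isClosed_Iic
  refine IsClosed.Icc_subset_of_forall_exists_gt (hs.inter isClosed_Icc) ?_ ?_
  · intro q hq hqa
    have : (0 : ℝ) ≤ q := by exact_mod_cast hq
    linarith
  rintro t ⟨hts, hta, htb⟩ z hz
  obtain ⟨x, hx, hxt⟩ := mem_iUnion₂.1 (hcover.ge (mem_univ (y t)))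
  obtain ⟨ε, hε, hεN⟩ := Metric.mem_nhdsWithin_iff.1
    ((hy.continuousOn t ⟨hta, htb.le⟩).preimage_mem_nhdsWithin ((hbox x).isOpen.mem_nhds hxt))
  -- A point already known to be in `W`, at rational delay and inside the flow box around `y t`:
  -- from it a single flow of rational duration `q - q₀` passes beyond `t`.
  obtain ⟨q₀, hq₀, hq₀t, hq₀ε, hq₀W⟩ : ∃ q₀ : ℚ, 0 ≤ q₀ ∧ a + q₀ ≤ t ∧ t - ε < a + q₀ ∧
      (⟨k, y (a + q₀)⟩ : H.State) ∈ W := by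
    rcases hta.eq_or_lt with rfl | hlt
    · exact ⟨0, le_rfl, by simp, by simpa using hε, by simpa using hya⟩
    · obtain ⟨q₀, h1, h2⟩ := exists_rat_btwn (show max 0 (t - ε - a) < t - a from
        max_lt (by linarith) (by linarith))
      have h3 := (le_max_left _ _).trans_lt h1
      have h4 := (le_max_right _ _).trans_lt h1
      have h5 : 0 ≤ q₀ := by exact_mod_cast h3.le
      exact ⟨q₀, h5, by linarith, by linarith, hts q₀ h5 (by linarith)⟩
  refine ⟨min z (min b (t + ε)), ?_, lt_min hz (lt_min htb (by linarith)), min_le_left _ _⟩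
  intro q hq hqt
  have hqb : a + q < b := hqt.trans_le ((min_le_right _ _).trans (min_le_left _ _))
  have hqε : a + q < t + ε := hqt.trans_le ((min_le_right _ _).trans (min_le_right _ _))
  rcases lt_or_ge (a + q) t with h | h
  · exact hts q hq h
  have hq₀' : (0 : ℝ) ≤ q₀ := by exact_mod_cast hq₀
  have hqq : (q₀ : ℝ) ≤ q := by linarith
  have hsum : a + (q₀ : ℝ) + ((q - q₀ : ℚ) : ℝ) = a + q := by push_cast; ring
  refine hrel x hx (q - q₀) (by rw [sub_nonneg]; exact_mod_cast hqq) _ _ hq₀W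
    ⟨y, a + q₀, ?_, fun r hr => ?_, rfl, by rw [hsum]⟩
  · rw [hsum]
    exact hy.mono (by linarith) hqb.le
  · rw [hsum] at hr
    refine hεN ⟨?_, by linarith [hr.1], by linarith [hr.2]⟩
    rw [Metric.mem_ball, Real.dist_eq, abs_lt]
    constructor <;> linarith [hr.1, hr.2]

/-- A rational-time flow first brings the trajectory close to its end on the guard; a short arc
inside one of countably many transverse boxes then remains, described by `HitRel`. -/
theorem isGeneratedProperty_hitClosed (hout : H.OutwardOnGuard) (k : J) :
    H.IsGeneratedProperty fun W => H.FlowClosed k W ∧ H.HitClosed k W := by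
  have hG : H.G k ⊆ (𝓡∂ (H.dim k)).boundary (H.D k) := by
    obtain ⟨O, _, hO⟩ := H.guard_open k
    rw [hO]
    exact inter_subset_right
  have hloc : ∀ x ∈ H.G k, ∃ N, IsOpen N ∧ x ∈ N ∧
      IsChartLipschitz (𝓡∂ (H.dim k)) (𝓡∂ (H.dim k)) (HitRel (H.F k) N (H.G k)) := fun x hx =>
    exists_isChartLipschitz_hitRel (H.smooth_F k)
      (hout k x hx _ (IsManifold.chart_mem_maximalAtlas x) (mem_chart_source _ x)) hG
  choose! N hN hxN hL using hloc
  obtain ⟨c, hcG, hc, hcover⟩ := TopologicalSpace.countable_cover_nhdsWithin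
    (f := N) (s := H.G k) fun x hx => mem_nhdsWithin_of_mem_nhds ((hN x hx).mem_nhds (hxN x hx))
  have hgen : H.IsGeneratedProperty fun W => ∀ x ∈ c, ∀ p q, (⟨k, p⟩ : H.State) ∈ W →
      HitRel (H.F k) (N x) (H.G k) p q → (⟨k, q⟩ : H.State) ∈ W := by
    refine ⟨(fun x => H.liftRel (HitRel (H.F k) (N x) (H.G k))) '' c, hc.image _, ?_, ?_⟩
    · rintro _ ⟨x, hx, rfl⟩
      exact ⟨k, k, _, hL x (hcG hx), rfl⟩
    · exact fun W hW x hx p q hp hpq => hW _ ⟨x, hx, rfl⟩ _ _ hp ⟨p, q, rfl, rfl, hpq⟩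
  refine ((H.isGeneratedProperty_flowClosed k).and hgen).mono fun W ⟨hflow, hW⟩ => ⟨hflow, ?_⟩
  intro y a b hab hy hya hyb
  rcases hab.eq_or_lt with rfl | hlt
  · exact hya
  obtain ⟨x, hx, hxb⟩ := mem_iUnion₂.1 (hcover hyb)
  obtain ⟨ε, hε, hεN⟩ := Metric.mem_nhdsWithin_iff.1
    ((hy.continuousOn b ⟨hab, le_rfl⟩).preimage_mem_nhdsWithin ((hN x (hcG hx)).mem_nhds hxb))
  obtain ⟨q, h1, h2⟩ := exists_rat_btwn (show max 0 (max (b - ε - a) (b - 1 - a)) < b - a from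
    max_lt (by linarith) (max_lt (by linarith) (by linarith)))
  have h3 := (le_max_left _ _).trans_lt h1
  have h4 := ((le_max_left _ _).trans (le_max_right _ _)).trans_lt h1
  have h5 := ((le_max_right _ _).trans (le_max_right _ _)).trans_lt h1
  have h6 := hflow y a b hy hya q (by exact_mod_cast h3.le) (by linarith)
  refine hW x hx _ _ h6 ⟨hyb, y, a + q, b, by linarith, by linarith,
    hy.mono (by linarith) le_rfl, fun r hr => ?_, rfl, rfl⟩
  refine hεN ⟨?_, by linarith [hr.1], hr.2⟩
  rw [Metric.mem_ball, Real.dist_eq, abs_lt]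
  constructor <;> linarith [hr.1, hr.2]

theorem isGeneratedProperty_reset (j : J) :
    H.IsGeneratedProperty fun W => ∀ p ∈ H.G j, (⟨j, p⟩ : H.State) ∈ W → H.R ⟨j, p⟩ ∈ W := by
  obtain ⟨O, hO, hGO⟩ := H.guard_open j
  have hloc : ∀ x : H.G j, ∃ (N : Set (H.D j)) (k : J) (r : H.D j → H.D k), IsOpen N ∧ x.1 ∈ N ∧
      (∀ p ∈ N, p ∈ H.G j → H.R ⟨j, p⟩ = ⟨k, r p⟩) ∧
      IsChartLipschitz (𝓡∂ (H.dim j)) (𝓡∂ (H.dim k)) fun a b => a ∈ N ∧ a ∈ H.G j ∧ r a = b := by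
    intro x
    obtain ⟨k, r, hR, hr⟩ := H.smooth_R j x x.2
    obtain ⟨N, hN, hxN, x₀, x₁, C, h1, h2⟩ :=
      exists_isChartLipschitz_of_contMDiffWithinAt hO hGO x.2 hr
    obtain ⟨o, ho, hxo, hoR⟩ := mem_nhdsWithin.1 hR
    refine ⟨N ∩ o, k, r, hN.inter ho, ⟨hxN, hxo⟩, fun p hp hpG => hoR ⟨hp.2, hpG⟩, x₀, x₁, C, ?_, ?_⟩
    · exact fun p q h => h1 p q ⟨h.1.1, h.2⟩
    · exact fun p q p' q' h h' => h2 p q p' q' ⟨h.1.1, h.2⟩ ⟨h'.1.1, h'.2⟩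
  choose N k r hN hxN hR hL using hloc
  obtain ⟨c, hc, hcover⟩ := TopologicalSpace.countable_cover_nhds
    fun x : H.G j => ((hN x).preimage continuous_subtype_val).mem_nhds (hxN x)
  refine ⟨(fun x => H.liftRel fun a b => a ∈ N x ∧ a ∈ H.G j ∧ r x a = b) '' c, hc.image _, ?_, ?_⟩
  · rintro _ ⟨x, hx, rfl⟩
    exact ⟨j, k x, _, hL x, rfl⟩
  · intro W hW p hp hpW
    obtain ⟨x, hx, hxp⟩ := mem_iUnion₂.1 (hcover.ge (mem_univ (⟨p, hp⟩ : H.G j)))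
    rw [hR x p hxp hp]
    exact hW _ ⟨x, hx, rfl⟩ _ _ hpW ⟨p, r x p, rfl, rfl, hxp, hp, rfl⟩

/-- The set `W` contains the guard of `D j` and is closed under the flow for rational times, under
following the flow up to the guard, and under resets. -/
structure IsReachClosed (j : J) (W : Set H.State) : Prop where
  guard_mem : ∀ p ∈ H.G j, (⟨j, p⟩ : H.State) ∈ W
  flow : ∀ k, H.FlowClosed k W
  hit : ∀ k, H.HitClosed k W
  reset : ∀ z ∈ H.guard, z ∈ W → H.R z ∈ W

/-- The states that can be reached after leaving the domain `D j` through the guard lie in a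
rectifiable set of dimension `dim j - 1`. -/
theorem exists_isReachClosed [Countable J] (hout : H.OutwardOnGuard) (j : J) :
    ∃ W : Set H.State, H.StateRectifiable (H.dim j - 1) W ∧ H.IsReachClosed j W := by
  have hA : H.StateRectifiable (H.dim j - 1) (Sigma.mk j '' H.G j) := by
    intro k
    by_cases hk : j = k
    · subst hk
      refine mRectifiable_boundary.mono ?_
      rintro p ⟨q, hq, hpq⟩
      obtain rfl := eq_of_heq (Sigma.mk.inj hpq).2
      obtain ⟨O, _, hO⟩ := H.guard_open j
      rw [hO] at hq
      exact hq.2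
    · refine MRectifiable.empty.mono ?_
      rintro p ⟨q, hq, hpq⟩
      exact hk (Sigma.mk.inj hpq).1
  obtain ⟨𝓕, h1, h2, h3⟩ := (IsGeneratedProperty.forall (H.isGeneratedProperty_hitClosed hout)).and
    (IsGeneratedProperty.forall H.isGeneratedProperty_reset)
  obtain ⟨W, hAW, hW, hcl⟩ := hA.exists_isClosedUnder h1 h2
  obtain ⟨h4, h5⟩ := h3 W hcl
  exact ⟨W, hW, fun p hp => hAW ⟨p, hp, rfl⟩, fun k => (h4 k).1, fun k => (h4 k).2,
    fun z hz hzW => h5 z.1 z.2 hz hzW⟩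

end HybridSystem

namespace HybridSystem

variable {J : Type u} {H : HybridSystem.{u, v} J}

/-! ### Executions between transitions -/

/-- Without transitions the execution is continuous, so by connectedness it stays in one summand;
the left limit supplies the end point. The time `a` may itself be a transition, where right
continuity suffices. -/
theorem IsExecution.exists_isTrajectory {χ : ℝ → H.State} {T : ℝ} (hχ : H.IsExecution χ (Ico 0 T))
    {a b : ℝ} (ha : 0 ≤ a) (hab : a < b) (hb : b ≤ T)
    (hc : ∀ t ∈ Ioo a b, ContinuousWithinAt χ (Ico 0 T) t) {k : J} {z : H.D k}
    (hz : Tendsto χ (𝓝[<] b) (𝓝 ⟨k, z⟩)) :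
    ∃ y : ℝ → H.D k, IsTrajectory (H.F k) y a b ∧ (∀ t ∈ Ico a b, χ t = ⟨k, y t⟩) ∧ y b = z := by
  classical
  have hsub : Ico a b ⊆ Ico 0 T := Ico_subset_Ico ha hb
  have hcont : ContinuousOn χ (Ico a b) := by
    intro t ht
    rcases ht.1.eq_or_lt with rfl | hlt
    · exact (hχ.rightContinuous a (hsub ht)).mono (subset_inter hsub Ico_subset_Ici_self)
    · exact (hc t ⟨hlt, ht.2⟩).mono hsub
  obtain ⟨i, S, -, hS⟩ := Sigma.isConnected_iff.1 ((isConnected_Ico hab).image χ hcont)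
  have hki : i = k := by
    have h1 : ∀ᶠ s in 𝓝[<] b, χ s ∈ range (Sigma.mk k) :=
      hz (IsOpenEmbedding.sigmaMk.isOpen_range.mem_nhds ⟨z, rfl⟩)
    obtain ⟨s, ⟨p, hp⟩, hs⟩ := (h1.and (Ico_mem_nhdsLT hab)).exists
    obtain ⟨p', -, hp'⟩ : χ s ∈ Sigma.mk i '' S := hS ▸ mem_image_of_mem χ hs
    exact (Sigma.mk.inj (hp'.trans hp.symm)).1
  subst hki
  have hex : ∀ t ∈ Ico a b, ∃ p : H.D i, χ t = ⟨i, p⟩ := fun t ht => by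
    obtain ⟨p, -, hp⟩ : χ t ∈ Sigma.mk i '' S := hS ▸ mem_image_of_mem χ ht
    exact ⟨p, hp.symm⟩
  let y : ℝ → H.D i := fun t => if h : t ∈ Ico a b then (hex t h).choose else z
  have hy : ∀ t ∈ Ico a b, χ t = ⟨i, y t⟩ := fun t ht => by
    simp only [y, dif_pos ht]
    exact (hex t ht).choose_spec
  have hyb : y b = z := dif_neg fun h => lt_irrefl _ h.2
  refine ⟨y, ⟨fun t ht => ?_, fun t ht => ?_⟩, hy, hyb⟩
  · rw [IsOpenEmbedding.sigmaMk.isInducing.continuousWithinAt_iff]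
    rcases ht.2.eq_or_lt with rfl | hlt
    · rw [← Ico_union_right hab.le, union_singleton, continuousWithinAt_insert_self]
      refine Tendsto.congr' ?_ ((hyb ▸ hz).mono_left (nhdsWithin_mono _ Ico_subset_Iio_self))
      filter_upwards [self_mem_nhdsWithin] with s hs
      exact hy s hs
    · have h1 : Ico a b ∈ 𝓝[Icc a b] t := by
        filter_upwards [self_mem_nhdsWithin, mem_nhdsWithin_of_mem_nhds (Iio_mem_nhds hlt)]
          with s hs hs'
        exact ⟨hs.1, hs'⟩
      refine ContinuousWithinAt.mono_of_mem_nhdsWithin ?_ h1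
      exact (hcont t ⟨ht.1, hlt⟩).congr (fun s hs => (hy s hs).symm) (hy t ⟨ht.1, hlt⟩).symm
  · have htI : t ∈ Ico 0 T := hsub (Ioo_subset_Ico_self ht)
    have hnhds : Ico 0 T ∈ 𝓝 t := Ico_mem_nhds (ha.trans_lt ht.1) (ht.2.trans_le hb)
    obtain ⟨j, y', he, hd⟩ := hχ.flow t htI (hc t ht)
    rw [nhdsWithin_eq_nhds.2 hnhds] at he
    obtain rfl : j = i :=
      (Sigma.mk.inj (he.self_of_nhds.symm.trans (hy t (Ioo_subset_Ico_self ht)))).1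
    have heq : y =ᶠ[𝓝 t] y' := by
      filter_upwards [he, Ico_mem_nhds ht.1 ht.2] with s hs hs'
      exact (eq_of_heq (Sigma.mk.inj (hs.symm.trans (hy s hs'))).2).symm
    rw [heq.self_of_nhds]
    exact (hd.hasMFDerivAt hnhds).congr_of_eventuallyEq heq

/-! ### Executions after a visit to `D j` -/

section Reach

variable {j : J} {W : Set H.State} {χ : ℝ → H.State} {T : ℝ}

/-- If the arc starts in `D j`, its exit point is in the guard of `D j`, which `W` contains;
otherwise it starts in `W` and `HitClosed` applies. -/
theorem IsExecution.leftLim_mem (hχ : H.IsExecution χ (Ico 0 T)) (hW : H.IsReachClosed j W) {d b : ℝ} (hd : 0 ≤ d) (hdb : d < b) (hb : b ≤ T)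
    (hc : ∀ t ∈ Ioo d b, ContinuousWithinAt χ (Ico 0 T) t) (hdW : (χ d).1 = j ∨ χ d ∈ W)
    {z : H.State} (hzG : z ∈ H.guard) (hz : Tendsto χ (𝓝[<] b) (𝓝 z)) : z ∈ W := by
  obtain ⟨k, z⟩ := z
  obtain ⟨y, hy, hχy, rfl⟩ := hχ.exists_isTrajectory hd hdb hb hc hz
  rw [hχy d ⟨le_rfl, hdb⟩] at hdW
  rcases hdW with rfl | hdW
  · exact hW.guard_mem _ hzG
  · exact hW.hit k y d b hdb.le hy hdW hzG

/-- Induction on the number of transitions in `(t₀, t]`. The hypothesis is applied just before the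
latest one, `c`; the arc up to `c` exits in `W`, and so its reset is in `W`. With no transitions the
execution is still governed by the alternative `D j`. -/
theorem IsExecution.exists_last_transition (hχ : H.IsExecution χ (Ico 0 T))
    (hW : H.IsReachClosed j W) (hfin : {t ∈ Ico 0 T | ¬ ContinuousWithinAt χ (Ico 0 T) t}.Finite) {t₀ : ℝ} (ht₀ : 0 ≤ t₀)
    (hj : (χ t₀).1 = j) (t : ℝ) (ht : t₀ ≤ t) (htT : t < T) :
    ∃ d ∈ Icc t₀ t, (∀ s ∈ Ioc d t, ContinuousWithinAt χ (Ico 0 T) s) ∧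
      ((χ d).1 = j ∨ χ d ∈ W) := by
  set D := {t ∈ Ico 0 T | ¬ ContinuousWithinAt χ (Ico 0 T) t} with hD
  have hfin' : ∀ t, (D ∩ Ioc t₀ t).Finite := fun t => hfin.subset inter_subset_left
  induction hn : (D ∩ Ioc t₀ t).ncard using Nat.strong_induction_on generalizing t with
  | _ n ih =>
  rcases (D ∩ Ioc t₀ t).eq_empty_or_nonempty with he | hne
  · refine ⟨t₀, ⟨le_rfl, ht⟩, fun s hs => ?_, Or.inl hj⟩
    by_contra hs'
    exact he.le ⟨⟨⟨ht₀.trans hs.1.le, hs.2.trans_lt htT⟩, hs'⟩, hs⟩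
  obtain ⟨c, hcD, hcmax⟩ := (hfin' t).exists_maximal hne
  have hc0 : 0 < c := ht₀.trans_lt hcD.2.1
  have hcT : c < T := hcD.2.2.trans_lt htT
  have hlast : ∀ s ∈ Ioc c t, ContinuousWithinAt χ (Ico 0 T) s := fun s hs => by
    by_contra hs'
    have := hcmax (y := s) ⟨⟨⟨hc0.le.trans hs.1.le, hs.2.trans_lt htT⟩, hs'⟩,
      hcD.2.1.trans hs.1, hs.2⟩ hs.1.le
    exact absurd hs.1 (not_lt.2 this)
  refine ⟨c, ⟨hcD.2.1.le, hcD.2.2⟩, hlast, Or.inr ?_⟩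
  obtain ⟨t', ⟨h1, h2⟩, h3⟩ : ∃ t' ∈ Ioo t₀ c, ∀ s ∈ Ioo t' c, s ∉ D := by
    have hev : ∀ᶠ s in 𝓝[<] c, s ∉ D := by
      have hcl : IsClosed (D \ {c}) := (hfin.subset sdiff_subset).isClosed
      have := hcl.isOpen_compl.mem_nhds (x := c) (by simp)
      filter_upwards [mem_nhdsWithin_of_mem_nhds this, self_mem_nhdsWithin] with s hs hsc hsD
      exact hs ⟨hsD, (ne_of_lt hsc)⟩
    obtain ⟨l, hl, hl'⟩ := (mem_nhdsLT_iff_exists_Ioo_subset).1 hev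
    obtain ⟨t', h1, h2⟩ := exists_between (max_lt hl hcD.2.1)
    exact ⟨t', ⟨(le_max_right _ _).trans_lt h1, h2⟩, fun s hs =>
      hl' ⟨((le_max_left _ _).trans_lt h1).trans hs.1, hs.2⟩⟩
  have hcard : (D ∩ Ioc t₀ t').ncard < n := by
    rw [← hn]
    refine ncard_lt_ncard ⟨?_, fun h => ?_⟩ (hfin' t)
    · exact inter_subset_inter_right _ (Ioc_subset_Ioc_right (h2.le.trans hcD.2.2))
    · exact absurd (h hcD).2.2 (not_le.2 h2)
  obtain ⟨d, hd, hdc, hdW⟩ := ih _ hcard t' h1.le (h2.trans hcT) rfl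
  obtain ⟨z, hzG, hz, hRz⟩ := hχ.jump c hcD.1.1 hcD.1.2
  have hnhd : 𝓝[Ico 0 T ∩ Iio c] c = 𝓝[<] c := by
    rw [inter_comm]
    exact nhdsWithin_inter_of_mem' (mem_nhdsWithin_of_mem_nhds (Ico_mem_nhds hc0 hcT))
  rw [hnhd] at hz
  rw [← hRz]
  refine hW.reset z hzG (hχ.leftLim_mem hW (ht₀.trans hd.1) (hd.2.trans_lt h2) hcT.le
    (fun s hs => ?_) hdW hzG hz)
  rcases le_or_gt s t' with h | h
  · exact hdc s ⟨hs.1, h⟩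
  · by_contra hs'
    exact h3 s ⟨h, hs.2⟩ ⟨⟨(ht₀.trans hd.1).trans hs.1.le, hs.2.trans hcT⟩, hs'⟩

/-- The first return point of an execution that has been in `D j` either lies in `W`, or is the end
of a trajectory that starts in `W` and has not met the section before. -/
theorem IsFirstReturn.mem_or_exists_isTrajectory {S : Set H.State} {x : H.State} {k : J} {w : H.D k}
    (h : H.IsFirstReturn S χ T x ⟨k, w⟩) (hW : H.IsReachClosed j W) {t₀ : ℝ} (ht₀ : t₀ ∈ Ico 0 T) (hj : (χ t₀).1 = j)
    (hjk : k ≠ j) :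
    (⟨k, w⟩ : H.State) ∈ W ∨ ∃ (y : ℝ → H.D k) (a b : ℝ), a < b ∧ IsTrajectory (H.F k) y a b ∧
      (⟨k, y a⟩ : H.State) ∈ W ∧ y b = w ∧ ∀ t ∈ Ioo a b, (⟨k, y t⟩ : H.State) ∉ S := by
  obtain ⟨z, hz, hw⟩ := h.arrive
  have hev : ∀ᶠ s in 𝓝[<] T, s ∉ {t ∈ Ico 0 T | ¬ ContinuousWithinAt χ (Ico 0 T) t} :=
    mem_nhdsWithin_of_mem_nhds (h.finite_transitions.isClosed.isOpen_compl.mem_nhds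
      fun hT => lt_irrefl _ hT.1.2)
  obtain ⟨l, hl, hl'⟩ := (mem_nhdsLT_iff_exists_Ioo_subset).1 hev
  obtain ⟨t, h1, h2⟩ := exists_between (max_lt hl ht₀.2)
  obtain ⟨d, hd, hdc, hdW⟩ := h.execution.exists_last_transition hW h.finite_transitions
    ht₀.1 hj t ((le_max_right _ _).trans h1.le) h2
  have hd0 : 0 ≤ d := ht₀.1.trans hd.1
  have hdT : d < T := hd.2.trans_lt h2
  have hc : ∀ s ∈ Ioo d T, ContinuousWithinAt χ (Ico 0 T) s := fun s hs => by
    rcases le_or_gt s t with hst | hst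
    · exact hdc s ⟨hs.1, hst⟩
    · by_contra hs'
      exact hl' ⟨((le_max_left _ _).trans_lt h1).trans hst, hs.2⟩
        ⟨⟨hd0.trans hs.1.le, hs.2⟩, hs'⟩
  -- The return happens either by flowing into the section or by a reset onto it. In the first case
  -- the last arc lies in `D k` with `k ≠ j`, so its start must be in `W`.
  rcases hw with rfl | ⟨-, hzG, hw⟩
  · right
    obtain ⟨y, hy, hχy, hyT⟩ := h.execution.exists_isTrajectory hd0 hdT le_rfl hc hz
    refine ⟨y, d, T, hdT, hy, ?_, hyT, fun s hs => ?_⟩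
    · rw [hχy d ⟨le_rfl, hdT⟩] at hdW
      exact hdW.resolve_left hjk
    · rw [← hχy s (Ioo_subset_Ico_self hs)]
      exact h.value_notMem s ⟨hd0.trans_lt hs.1, hs.2⟩
  · left
    rw [hw]
    exact hW.reset z hzG (h.execution.leftLim_mem hW hd0 hdT le_rfl hc hdW hzG hz)

end Reach

/-! ### First arrival at the section -/

/-- The points of a locally closed set `Q` that lie in `W` or where a trajectory from `W` first
meets `Q` form a null set for the Hausdorff measure of dimension `m + 1`, locally in charts. -/
theorem exists_hausdorffMeasure_eq_zero {m : ℕ} {W : Set H.State} (hW : H.StateRectifiable m W)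
    {k : J} (hflow : H.FlowClosed k W) {Q : Set (H.D k)} (hQ : IsLocallyClosed Q)
    {x₀ : H.D k} (hx₀ : x₀ ∈ Q) :
    ∃ N, IsOpen N ∧ x₀ ∈ N ∧ N ⊆ (chartAt (EuclideanHalfSpace (H.dim k)) x₀).source ∧
      μH[(m + 1 : ℕ)] (extChartAt (𝓡∂ (H.dim k)) x₀ '' {w ∈ N ∩ Q | (⟨k, w⟩ : H.State) ∈ W ∨
        ∃ (y : ℝ → H.D k) (a b : ℝ), a < b ∧ IsTrajectory (H.F k) y a b ∧
          (⟨k, y a⟩ : H.State) ∈ W ∧ y b = w ∧ ∀ t ∈ Ioo a b, y t ∉ Q}) = 0 := by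
  obtain ⟨O, C, hO, hC, rfl⟩ := hQ
  obtain ⟨N₀, K, V, hxN₀, hbox⟩ := exists_isFlowBox (H.smooth_F k) x₀
  set φ := extChartAt (𝓡∂ (H.dim k)) x₀ with hφ
  obtain ⟨r, hr, T, hT, hnull⟩ := hausdorffMeasure_firstHit hbox.lipschitz (φ x₀)
  set N := N₀ ∩ (O ∩ ((chartAt (EuclideanHalfSpace (H.dim k)) x₀).source ∩
    φ ⁻¹' Metric.ball (φ x₀) r)) with hN
  have hboxN : IsFlowBox (H.F k) x₀ N K V :=
    hbox.inter (hO.inter (isOpen_extChartAt_preimage x₀ Metric.isOpen_ball))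
  have hxN : x₀ ∈ N := ⟨hxN₀, hx₀.1, mem_chart_source _ _, Metric.mem_ball_self hr⟩
  refine ⟨N, hboxN.isOpen, hxN, hboxN.subset, ?_⟩
  have hWφ := hW k x₀
  refine measure_mono_null ?_ (measure_union_null hWφ.hausdorffMeasure_eq_zero
    (hnull hWφ (isClosed_closure (s := φ '' (N ∩ C)))))
  rintro _ ⟨w, ⟨⟨hwN, hwQ⟩, hw | ⟨y, a, b, hab, hy, hyW, rfl, hyQ⟩⟩, rfl⟩
  · exact Or.inl ⟨w, ⟨hw, hboxN.subset hwN⟩, rfl⟩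
  right
  obtain ⟨ε, hε, hεN⟩ := Metric.mem_nhdsWithin_iff.1
    ((hy.continuousOn b ⟨hab.le, le_rfl⟩).preimage_mem_nhdsWithin (hboxN.isOpen.mem_nhds hwN))
  -- Restart at a rational delay, inside `N` and within `T` of the end. The delay is strictly
  -- positive because `y a` itself may lie in `Q`.
  obtain ⟨q, h1, h2⟩ := exists_rat_btwn (show max 0 (max (b - ε - a) (b - T - a)) < b - a from
    max_lt (by linarith) (max_lt (by linarith) (by linarith)))
  have h3 := (le_max_left _ _).trans_lt h1
  have h4 := ((le_max_left _ _).trans (le_max_right _ _)).trans_lt h1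
  have h5 := ((le_max_right _ _).trans (le_max_right _ _)).trans_lt h1
  have h6 := hflow y a b hy hyW q (by exact_mod_cast h3.le) (by linarith)
  have hyN : ∀ s ∈ Icc (a + (q : ℝ)) b, y s ∈ N := fun s hs => by
    refine hεN ⟨?_, by linarith [hs.1], hs.2⟩
    rw [Metric.mem_ball, Real.dist_eq, abs_lt]
    constructor <;> linarith [hs.1, hs.2]
  have hyq := hyN _ ⟨le_rfl, by linarith⟩
  -- Taking the closure in the model space, to obtain a closed target, creates no new hits inside
  -- `N`.
  have hclosure : ∀ p ∈ N, φ p ∈ closure (φ '' (N ∩ C)) → p ∈ C := by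
    intro p hp hpC
    have hps : p ∈ φ.source := by
      rw [hφ, extChartAt_source]
      exact hboxN.subset hp
    have hmaps : MapsTo φ.symm (φ '' (N ∩ C)) C := by
      rintro _ ⟨c, hc, rfl⟩
      rw [φ.left_inv]
      · exact hc.2
      · rw [hφ, extChartAt_source]
        exact hboxN.subset hc.1
    have hcont : ContinuousWithinAt φ.symm (φ '' (N ∩ C)) (φ p) :=
      (continuousAt_extChartAt_symm' hps).continuousWithinAt
    have := hcont.mem_closure hpC hmaps
    rwa [hC.closure_eq, φ.left_inv hps] at this
  refine ⟨_, b - (a + q), by linarith, by linarith,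
    hboxN.isSolutionOn_shift (hy.mono (by linarith) le_rfl) hyN, ?_, ?_, ?_, ?_, ?_⟩
  · exact ⟨y (a + q), ⟨h6, hboxN.subset hyq⟩, by rw [add_zero]⟩
  · rw [add_zero]
    exact Metric.ball_subset_closedBall hyq.2.2.2
  · rw [add_sub_cancel]
  · exact subset_closure ⟨y b, ⟨hwN, hwQ.2⟩, rfl⟩
  · intro t ht htC
    have htN := hyN (a + q + t) ⟨by linarith [ht.1], by linarith [ht.2]⟩
    exact hyQ (a + q + t) ⟨by linarith [ht.1], by linarith [ht.2]⟩
      ⟨htN.2.1, hclosure _ htN htC⟩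

end HybridSystem

/-! ### The rank of a map whose image is a null set -/

section Rank

variable {E F : Type*} [NormedAddCommGroup E] [NormedSpace ℝ E]
  [NormedAddCommGroup F] [NormedSpace ℝ F]

theorem exists_surjective_comp [FiniteDimensional ℝ F] (A : E →L[ℝ] F) {k : ℕ}
    (hk : k ≤ Module.finrank ℝ (LinearMap.range A.toLinearMap)) :
    ∃ L : F →L[ℝ] (Fin k → ℝ), Function.Surjective (L.comp A) := by
  let e : LinearMap.range A.toLinearMap ≃ₗ[ℝ]
      (Fin (Module.finrank ℝ (LinearMap.range A.toLinearMap)) → ℝ) :=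
    LinearEquiv.ofFinrankEq _ _ (by simp)
  let π := (LinearMap.funLeft ℝ ℝ (Fin.castLE hk)).comp e.toLinearMap
  have hπ : Function.Surjective π :=
    (LinearMap.funLeft_surjective_of_injective ℝ ℝ _ (Fin.castLE_injective hk)).comp e.surjective
  obtain ⟨L, hL⟩ := LinearMap.exists_extend π
  refine ⟨L.toContinuousLinearMap, fun z => ?_⟩
  obtain ⟨⟨_, x, rfl⟩, hy⟩ := hπ z
  exact ⟨x, hy ▸ LinearMap.congr_fun hL ⟨_, x, rfl⟩⟩

/-- Were the rank larger, a linear map `L` to `ℝ ^ (m + 1)` would make `L ∘ g` submersive near `x₀`,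
so `L '' Z` would contain an open set although it is null. -/
theorem finrank_range_fderivWithin_le [FiniteDimensional ℝ E] [FiniteDimensional ℝ F]
    [MeasurableSpace F] [BorelSpace F] {g : E → F} {s : Set E} (hs : Convex ℝ s)
    (hs' : (interior s).Nonempty) {x₀ : E} (hx₀ : x₀ ∈ s) (hg : ContDiffWithinAt ℝ 1 g s x₀)
    {Z : Set F} {m : ℕ} (hZ : μH[(m + 1 : ℕ)] Z = 0) (hgZ : ∀ᶠ u in 𝓝[s] x₀, g u ∈ Z) :
    Module.finrank ℝ (LinearMap.range (fderivWithin ℝ g s x₀).toLinearMap) ≤ m := by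
  by_contra! hm
  obtain ⟨L, hL⟩ := exists_surjective_comp _ (Nat.succ_le_of_lt hm)
  have hud : UniqueDiffOn ℝ s := uniqueDiffOn_convex hs hs'
  obtain ⟨σ, hσ⟩ := LinearMap.exists_rightInverse_of_surjective
    (L.comp (fderivWithin ℝ g s x₀)).toLinearMap (LinearMap.range_eq_top.2 hL)
  let σ' := σ.toContinuousLinearMap
  let d : E → ℝ := fun u => ((L.comp (fderivWithin ℝ g s u)).comp σ').det
  have hd0 : d x₀ = 1 := by
    have : (L.comp (fderivWithin ℝ g s x₀)).comp σ' = ContinuousLinearMap.id ℝ _ := by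
      ext1 z
      exact LinearMap.congr_fun hσ z
    simp only [d, this]
    exact LinearMap.det_id
  have hdc : ContinuousWithinAt d s x₀ := by
    have h1 := (hg.fderivWithin_right hud (m := 0) (by simp) hx₀).continuousWithinAt
    have h2 : Continuous fun D : E →L[ℝ] F => ((L.comp D).comp σ').det :=
      ContinuousLinearMap.continuous_det.comp (by fun_prop)
    exact h2.continuousAt.comp_continuousWithinAt h1
  have hev1 : ∀ᶠ u in 𝓝[s] x₀, d u ≠ 0 := hdc.eventually_ne (by rw [hd0]; exact one_ne_zero)
  have hev2 := hg.eventually (by simp)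
  rw [insert_eq_of_mem hx₀] at hev2
  -- The point `x₀` may lie on the boundary of `s`; the nonvanishing determinant `d` carries
  -- surjectivity to a nearby interior point, where the open mapping argument works.
  have hx₀c : x₀ ∈ closure (interior s) := by
    rw [hs.closure_interior_eq_closure_of_nonempty_interior hs']
    exact subset_closure hx₀
  have hev := (hev1.and (hev2.and (eventually_eventually_nhdsWithin.2 hgZ)))
  obtain ⟨o, ho, hxo, hos⟩ := mem_nhdsWithin.1 hev
  obtain ⟨u, huo, hus⟩ := mem_closure_iff.1 hx₀c o ho hxo
  obtain ⟨hdu, hgu, hZu⟩ := hos ⟨huo, interior_subset hus⟩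
  have hsu : s ∈ 𝓝 u := mem_interior_iff_mem_nhds.1 hus
  rw [nhdsWithin_eq_nhds.2 hsu] at hZu
  have hstrict := (hgu.contDiffAt hsu).hasStrictFDerivAt one_ne_zero
  have hstrict' := L.hasStrictFDerivAt.comp u hstrict
  rw [← fderivWithin_of_mem_nhds hsu] at hstrict'
  have hsurj : (L.comp (fderivWithin ℝ g s u)).range = ⊤ := by
    rw [LinearMap.range_eq_top]
    have hunit := LinearMap.isUnit_iff_isUnit_det _ |>.2 (isUnit_iff_ne_zero.2 hdu)
    have hb := ((Module.End.isUnit_iff _).1 hunit).2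
    intro z
    obtain ⟨w, hw⟩ := hb z
    exact ⟨σ' w, hw⟩
  have hmap := hstrict'.map_nhds_eq_of_surj hsurj
  have hmem : L '' Z ∈ 𝓝 (L (g u)) := by
    rw [← hmap, mem_map]
    filter_upwards [hZu] with w hw
    exact ⟨_, hw, rfl⟩
  have hpos := measure_pos_of_mem_nhds volume hmem
  have hnull := L.lipschitz.hausdorffMeasure_image_le (d := (m + 1 : ℕ)) (Nat.cast_nonneg _) Z
  have hcard : (μH[(m + 1 : ℕ)] : Measure (Fin (m + 1) → ℝ)) = volume := by
    rw [← hausdorffMeasure_pi_real, Fintype.card_fin]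
  rw [hZ, mul_zero, hcard] at hnull
  exact absurd hpos (not_lt.2 hnull)

end Rank

/-! ### From the null set to the rank of the Poincaré map -/

theorem finrank_range_le_of_comp {E F F' : Type*} [NormedAddCommGroup E] [NormedSpace ℝ E]
    [NormedAddCommGroup F] [NormedSpace ℝ F] [NormedAddCommGroup F'] [NormedSpace ℝ F']
    {A : E →L[ℝ] F} {D : F →L[ℝ] F'} {C : E →L[ℝ] F'} (hD : Function.Injective D)
    (hC : D.comp A = C) {m : ℕ} (hm : Module.finrank ℝ (LinearMap.range C.toLinearMap) ≤ m) :
    Module.finrank ℝ (LinearMap.range A.toLinearMap) ≤ m := by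
  subst hC
  rw [ContinuousLinearMap.toLinearMap_comp, LinearMap.range_comp] at hm
  rwa [← (Submodule.equivMapOfInjective D.toLinearMap hD _).finrank_eq] at hm

/-- A compact neighbourhood has closed image in a Hausdorff space, and by the embedding property
this image agrees with the range near the point. -/
theorem Topology.IsEmbedding.isLocallyClosed_range {X Y : Type*} [TopologicalSpace X]
    [TopologicalSpace Y] [LocallyCompactSpace X] [T2Space Y] {f : X → Y} (hf : IsEmbedding f) :
    IsLocallyClosed (range f) := by
  have h := (isLocallyClosed_tfae (range f)).out 0 2
  rw [h]
  rintro _ ⟨x, rfl⟩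
  obtain ⟨K, hK, hxK⟩ := exists_compact_mem_nhds x
  rw [hf.nhds_eq_comap, mem_comap] at hxK
  obtain ⟨t, ht, htK⟩ := hxK
  refine ⟨t, ht, ?_⟩
  have : IsClosed (f '' K) := (hK.image hf.continuous).isClosed
  convert this.preimage (continuous_subtype_val (p := (· ∈ t))) using 1
  ext ⟨y, hy⟩
  constructor
  · rintro ⟨x', rfl⟩
    exact ⟨x', htK hy, rfl⟩
  · rintro ⟨x', -, rfl⟩
    exact ⟨x', rfl⟩

theorem mainTheorem10 {J : Type u} [Finite J] (H : HybridSystem.{u, v} J)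
    (hout : H.OutwardOnGuard)
    (γ : ℝ → H.State) (τ : ℝ) (hγ : H.IsPeriodicOrbit γ τ) (hiso : H.IsolatedTransitions γ)
    {E : Type*} [NormedAddCommGroup E] [NormedSpace ℝ E] [FiniteDimensional ℝ E]
    {B : Type*} [TopologicalSpace B] (I : ModelWithCorners ℝ E B)
    {S : Type*} [TopologicalSpace S] [ChartedSpace B S] [IsManifold I ∞ S]
    {j₀ : J} (ι : S → H.D j₀) (ξ : S) (U : Set S) (P : S → S)
    (hP : H.IsPoincareMap γ I ι ξ U P) :
    ∀ p ∈ U, ∀ j ∈ H.visited γ,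
      Module.finrank ℝ (LinearMap.range (mfderiv I I P p).toLinearMap) ≤ H.dim j - 1 := by
  intro p hp j hj
  by_cases hj₀ : j₀ = j
  · subst hj₀
    have h1 : Module.finrank ℝ (LinearMap.range (mfderiv I I P p).toLinearMap) ≤
        Module.finrank ℝ E := Submodule.finrank_le (R := ℝ) (M := E) _
    have := hP.isSection.codim_one
    omega
  have := I.locallyCompactSpace
  have := ChartedSpace.locallyCompactSpace B S
  have hQ : IsLocallyClosed (range ι) := hP.isSection.embedding.isLocallyClosed_range
  obtain ⟨W, hWr, hW⟩ := H.exists_isReachClosed hout j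
  obtain ⟨N, hN, hpN, hNs, hnull⟩ := HybridSystem.exists_hausdorffMeasure_eq_zero hWr (hW.flow j₀)
    hQ (mem_range_self (P p))
  have hUn : U ∈ 𝓝 p := hP.isOpen.mem_nhds hp
  have hPp : ContMDiffAt I I ∞ P p := hP.smooth.contMDiffAt hUn
  have hΨ : ContMDiffAt I (𝓡∂ (H.dim j₀)) ∞ (ι ∘ P) p := (hP.isSection.smooth (P p)).comp p hPp
  have hcomp : mfderiv I (𝓡∂ (H.dim j₀)) (ι ∘ P) p =
      (mfderiv I (𝓡∂ (H.dim j₀)) ι (P p)).comp (mfderiv I I P p) :=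
    mfderiv_comp p ((hP.isSection.smooth (P p)).mdifferentiableAt (by simp))
      (hPp.mdifferentiableAt (by simp))
  have hmf : mfderiv I (𝓡∂ (H.dim j₀)) (ι ∘ P) p =
      fderivWithin ℝ (writtenInExtChartAt I (𝓡∂ (H.dim j₀)) p (ι ∘ P)) (range I)
        (extChartAt I p p) :=
    (hΨ.mdifferentiableAt (by simp)).mfderiv
  have hsmooth := ((contMDiffAt_iff.1 hΨ).2.of_le (m := 1) (by simp))
  -- The rank is computed for `ι ∘ P` in a chart of `D j₀`; injectivity of the differential of `ι`
  -- transfers the bound to `P`.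
  refine finrank_range_le_of_comp (E := E) (F := E) (F' := EuclideanSpace ℝ (Fin (H.dim j₀)))
    (hP.isSection.immersion (P p)) (hcomp.symm.trans hmf)
    (finrank_range_fderivWithin_le I.convex_range I.nonempty_interior
      (mem_range_self _) hsmooth hnull ?_)
  have hcs : ContinuousAt (extChartAt I p).symm (extChartAt I p p) :=
    continuousAt_extChartAt_symm p
  have h1 : ∀ᶠ q in 𝓝 p, q ∈ U ∧ ι (P q) ∈ N :=
    (hP.isOpen.eventually_mem hp).and (hΨ.continuousAt.eventually (hN.mem_nhds hpN))
  have h2 : ∀ᶠ u in 𝓝 (extChartAt I p p), (extChartAt I p).symm u ∈ U ∧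
      ι (P ((extChartAt I p).symm u)) ∈ N := by
    rw [ContinuousAt, extChartAt_to_inv] at hcs
    exact hcs.eventually h1
  filter_upwards [mem_nhdsWithin_of_mem_nhds h2] with u ⟨huU, huN⟩
  refine ⟨_, ⟨⟨huN, mem_range_self _⟩, ?_⟩, rfl⟩
  obtain ⟨χ, T, hret, hvis⟩ := hP.returns _ huU
  obtain ⟨t₀, ht₀, hjt⟩ := (hvis j hj).resolve_left (Ne.symm hj₀)
  refine (hret.mem_or_exists_isTrajectory hW ht₀ hjt hj₀).imp_right ?_
  rintro ⟨y, a, b, hab, hy, hyW, hyb, hyQ⟩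
  refine ⟨y, a, b, hab, hy, hyW, hyb, fun t ht ⟨q, hq⟩ => hyQ t ht ⟨q, ?_⟩⟩
  simp only [hq]
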